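/- **Setting.** Let $d\ge 0$, $1\le S\le N$ and $b\ge 1$ be integers, and let $L>0$, $\Lambda\ge L$, $\sigma\ge 0$, $\omega\ge 0$, $\epsilon>0$ be real numbers. Let $f_1,\dots,f_N:\mathbb R^d\to\mathbb R$ be differentiable and $L$-smooth, that is, $\|\nabla f_i(x)-\nabla f_i(y)\|\le L\|x-y\|$ for all $x,y$ and $i$, and assume that $f=\frac1N\sum_{i=1}^N f_i$ is bounded below, with $f^*=\inf f$. Each client $i$ has an unbiased stochastic gradient oracle $\tilde\nabla f_i(x)=G_i(x,z)$, with $z$ drawn from its data distribution $\mathcal D_i$, such that $\mathbb E\,\tilde\nabla f_i(x)=\nabla f_i(x)$ and $\mathbb E\|\tilde\nabla f_i(x)-\nabla f_i(x)\|^2\le\sigma^2$ for all $x$; the minibatch gradient $\tilde\nabla_b f_i(x)$ is the average of $b$ independent copies of $\tilde\nabla f_i(x)$. Let $\mathcal C$ be a randomized map on $\mathbb R^d$ with $\mathbb E\,\mathcal C(x)=x$ and $\mathbb E\|\mathcal C(x)-x\|^2\le\omega\|x\|^2$ for all $x$. **COFIG.** Given $x^0$, $h^0_1,\dots,h^0_N\in\mathbb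 R^d$, step sizes $\eta$ and $\alpha$, and $h^0=\frac1N\sum_i h_i^0$, communication round $t=0,1,2,\dots$ does the following. Draw two independent, uniformly random sets $\mathcal S^t,\tilde{\mathcal S}^t$ of $S$ of the $N$ clients. Clients $i\in\mathcal S^t$ send $u_i^t=\mathcal C(\tilde\nabla_bf_i(x^t)-h_i^t)$ and set $h_i^{t+1}=h_i^t+\alpha u_i^t$, while $h_j^{t+1}=h_j^t$ for $j\notin\mathcal S^t$. Clients $i\in\tilde{\mathcal S}^t$ send $v_i^t=\mathcal C(\tilde\nabla_bf_i(x^t)-h_i^t)$. The server sets $$g^t=\frac1S\sum_{i\in\tilde{\mathcal S}^t}v_i^t+h^t,\qquad x^{t+1}=x^t-\eta g^t,\qquad h^{t+1}=h^t+\frac{\alpha}{N}\sum_{i\in\mathcal S^t}u_i^t .$$ The sampled sets, the minibatches of different clients and rounds, and all uses of the compressor are independent; the minibatches used by the same client in the same round for $u_i^t$ and for $v_i^t$ may depend on each other in any way (they may be independent, or equal). **Theorem (COFIG in the nonconvex case).** There is an absolute constant $K>0$ such that in every such setting the following holds. Take $\alpha=\frac1{1+\omega}$ and $$\eta=\min\Big\{\frac1{2L},\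 \frac{S}{5L(1+\omega)N^{2/3}},\ \frac{S}{5L(1+\omega)^{3/2}\sqrt N},\ \frac{bS\epsilon^2}{20\Lambda(1+\omega)\sigma^2}\Big\},$$ where the last term is omitted if $\sigma=0$. Put $$R=\frac{L}{\epsilon^2}+\frac{L(1+\omega)N^{2/3}}{S\epsilon^2}+\frac{L(1+\omega)^{3/2}\sqrt N}{S\epsilon^2}+\frac{\Lambda(1+\omega)\sigma^2}{bS\epsilon^4},\qquad \Delta_0=f(x^0)-f^*+\frac1L\cdot\frac1N\sum_{i=1}^N\|h_i^0-\nabla f_i(x^0)\|^2 .$$ Then $\mathbb E\|\nabla f(x^t)\|<\infty$ for all $t$, and COFIG finds an $x$ with $\mathbb E\|\nabla f(x)\|\le\epsilon$ within $K\Delta_0R$, that is $O(R)$, communication rounds: there is $t\le K\Delta_0R$ with $\mathbb E\|\nabla f(x^t)\|\le\epsilon$. Moreover, for every integer $T\ge\max\{1,K\Delta_0R\}$, $$\frac1T\sum_{t=0}^{T-1}\mathbb E\|\nabla f(x^t)\|\le\epsilon ,$$ that is, an iterate chosen uniformly at random among $x^0,\dots,x^{T-1}$ has this property. (One may take $\Lambda=L$;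 if $L\le1$ one may also take $\Lambda=1$.) -/

import Mathlib

open MeasureTheory ProbabilityTheory

universe u v w

noncomputable section

namespace Cofig

/-- The model space `ℝ^d` with the Euclidean norm. -/
abbrev Vec (d : ℕ) : Type := EuclideanSpace ℝ (Fin d)

/-- The global objective `f = (1/N) ∑ i, f i`. -/
def objective {d N : ℕ} (f : Fin N → Vec d → ℝ) (x : Vec d) : ℝ :=
  (1 / (N : ℝ)) * ∑ i, f i x

/-- `L`-smoothness of all local functions. -/
def IsSmooth {d N : ℕ} (f : Fin N → Vec d → ℝ) (L : ℝ) : Prop :=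
  ∀ i, Differentiable ℝ (f i) ∧
    ∀ x y, ‖gradient (f i) x - gradient (f i) y‖ ≤ L * ‖x - y‖

/-- `G i x z` is the stochastic gradient that client `i` computes at `x` from a data sample `z`.
With `z` drawn from the local data distribution `D i` it is unbiased for the gradient of `f i`,
with variance at most `σ ^ 2`. -/
structure IsStochasticGradient {d N : ℕ} {Z : Type*} [MeasurableSpace Z]
    (f : Fin N → Vec d → ℝ) (D : Fin N → Measure Z) (G : Fin N → Vec d → Z → Vec d)
    (σ : ℝ) : Prop where
  measurable : ∀ i, Measurable fun q : Vec d × Z => G i q.1 q.2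
  unbiased : ∀ i x, ∫ z, G i x z ∂(D i) = gradient (f i) x
  integrable_sq : ∀ i x, Integrable (fun z => ‖G i x z - gradient (f i) x‖ ^ 2) (D i)
  variance_le : ∀ i x, ∫ z, ‖G i x z - gradient (f i) x‖ ^ 2 ∂(D i) ≤ σ ^ 2

/-- An `ω`-compression operator: a randomized map on `ℝ^d`, whose random seed has law `ν`. -/
structure IsCompressor {d : ℕ} {Ξ : Type*} [MeasurableSpace Ξ]
    (ν : Measure Ξ) (C : Vec d → Ξ → Vec d) (ω : ℝ) : Prop where
  measurable : Measurable fun q : Vec d × Ξ => C q.1 q.2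
  unbiased : ∀ x, ∫ s, C x s ∂ν = x
  integrable_sq : ∀ x, Integrable (fun s => ‖C x s - x‖ ^ 2) ν
  variance_le : ∀ x, ∫ s, ‖C x s - x‖ ^ 2 ∂ν ≤ ω * ‖x‖ ^ 2

/-- The minibatch stochastic gradient: the average of the `b` stochastic gradients at `x`. -/
def minibatchGrad {d b : ℕ} {Z : Type*} (Gi : Vec d → Z → Vec d) (x : Vec d) (z : Fin b → Z) :
    Vec d :=
  (1 / (b : ℝ)) • ∑ k, Gi x (z k)

/-! ### The algorithm -/

/-- State at the beginning of a round: the model `x`, the local shifts `hloc i`, the virtual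
points `w i`, and the shift `h` of the server. -/
structure State (d N : ℕ) where
  x : Vec d
  hloc : Fin N → Vec d
  w : Fin N → Vec d
  h : Vec d

/-- Randomness of one client in one round: the two minibatches and the two compressor seeds that
are used for the messages `u i` and `v i`, in this order. -/
abbrev ClientNoise (b : ℕ) (Z Ξ : Type*) : Type _ :=
  ((Fin b → Z) × (Fin b → Z)) × (Ξ × Ξ)

/-- Randomness of one round: the two sampled sets of clients and the noise of each client. -/
abbrev RoundNoise (N b : ℕ) (Z Ξ : Type*) : Type _ :=
  (Finset (Fin N) × Finset (Fin N)) × (Fin N → ClientNoise b Z Ξ)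

section Algorithm

variable {d N b : ℕ} {Z Ξ : Type*}

/-- The message `u i = C (minibatch gradient at x - hloc i)`, used to update the shifts. -/
def messageU (G : Fin N → Vec d → Z → Vec d) (C : Vec d → Ξ → Vec d)
    (s : State d N) (r : RoundNoise N b Z Ξ) (i : Fin N) : Vec d :=
  C (minibatchGrad (G i) s.x (r.2 i).1.1 - s.hloc i) (r.2 i).2.1

/-- The message `v i = C (minibatch gradient at x - hloc i)`, used to update the model. -/
def messageV (G : Fin N → Vec d → Z → Vec d) (C : Vec d → Ξ → Vec d)
    (s : State d N) (r : RoundNoise N b Z Ξ) (i : Fin N) : Vec d :=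
  C (minibatchGrad (G i) s.x (r.2 i).1.2 - s.hloc i) (r.2 i).2.2

/-- The gradient estimate of the server, from the clients in the second sampled set. -/
def estimate (G : Fin N → Vec d → Z → Vec d) (C : Vec d → Ξ → Vec d) (S : ℕ)
    (s : State d N) (r : RoundNoise N b Z Ξ) : Vec d :=
  (1 / (S : ℝ)) • ∑ i ∈ r.1.2, messageV G C s r i + s.h

/-- One communication round of COFIG. -/
def step (G : Fin N → Vec d → Z → Vec d) (C : Vec d → Ξ → Vec d) (S : ℕ) (η α : ℝ)
    (s : State d N) (r : RoundNoise N b Z Ξ) : State d N where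
  x := s.x - η • estimate G C S s r
  hloc := fun i => if i ∈ r.1.1 then s.hloc i + α • messageU G C s r i else s.hloc i
  w := fun i => if i ∈ r.1.1 then s.x else s.w i
  h := s.h + (α / (N : ℝ)) • ∑ i ∈ r.1.1, messageU G C s r i

/-- Initial state, for an initial model `x₀` and initial local shifts `h₀`. -/
def initState (x₀ : Vec d) (h₀ : Fin N → Vec d) : State d N where
  x := x₀
  hloc := h₀
  w := fun _ => x₀
  h := (1 / (N : ℝ)) • ∑ i, h₀ i

/-- The state of COFIG after `t` communication rounds, when round `t` uses the noise `r t`. -/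
def run (G : Fin N → Vec d → Z → Vec d) (C : Vec d → Ξ → Vec d) (S : ℕ) (η α : ℝ)
    (x₀ : Vec d) (h₀ : Fin N → Vec d) (r : ℕ → RoundNoise N b Z Ξ) : ℕ → State d N
  | 0 => initState x₀ h₀
  | t + 1 => step G C S η α (run G C S η α x₀ h₀ r t) (r t)

end Algorithm

/-! ### The law of the randomness -/

/-- A uniformly random set of `S` of the `N` clients. -/
def clientLaw (N S : ℕ) : Measure (Finset (Fin N)) :=
  uniformOn {A : Finset (Fin N) | A.card = S}

/-- `κ` is a law of a pair of minibatches, each of which consists of `b` independent samples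
from `Di`. How the two minibatches depend on each other is left free: they may be
independent, and they may be equal. -/
structure IsMinibatchPairLaw {b : ℕ} {Z : Type*} [MeasurableSpace Z] (Di : Measure Z)
    (κ : Measure ((Fin b → Z) × (Fin b → Z))) : Prop where
  map_fst : κ.map Prod.fst = Measure.pi fun _ => Di
  map_snd : κ.map Prod.snd = Measure.pi fun _ => Di

/-- The law of the randomness of one round: the two sets of clients, the minibatches of the
different clients and all compressor seeds are independent. -/
def roundLaw {N b : ℕ} {Z Ξ : Type*} [MeasurableSpace Z] [MeasurableSpace Ξ] (S : ℕ)
    (κ : Fin N → Measure ((Fin b → Z) × (Fin b → Z))) (ν : Measure Ξ) :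
    Measure (RoundNoise N b Z Ξ) :=
  ((clientLaw N S).prod (clientLaw N S)).prod
    (Measure.pi fun i => (κ i).prod (ν.prod ν))

/-! ### Step size and number of rounds -/

/-- The step size. The last term of the minimum is `+∞`, hence absent, if `σ = 0`. -/
def stepSize (N S b : ℕ) (L Λ σ ω ε : ℝ) : ℝ :=
  let m₃ := min (1 / (2 * L))
    (min ((S : ℝ) / (5 * L * (1 + ω) * (N : ℝ) ^ (2 / 3 : ℝ)))
      ((S : ℝ) / (5 * L * (1 + ω) ^ (3 / 2 : ℝ) * Real.sqrt N)))
  if σ = 0 then m₃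
  else min m₃ ((b : ℝ) * S * ε ^ 2 / (20 * Λ * (1 + ω) * σ ^ 2))

/-- The order of the number of communication rounds. -/
def rate (N S b : ℕ) (L Λ σ ω ε : ℝ) : ℝ :=
  L / ε ^ 2
    + L * (1 + ω) * (N : ℝ) ^ (2 / 3 : ℝ) / (S * ε ^ 2)
    + L * (1 + ω) ^ (3 / 2 : ℝ) * Real.sqrt N / (S * ε ^ 2)
    + Λ * (1 + ω) * σ ^ 2 / (b * S * ε ^ 4)

/-- The size of the initial error: `f(x₀) - f^*` plus `1/L` times the mean squared error of the
initial local shifts. -/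
def initialError {d N : ℕ} (f : Fin N → Vec d → ℝ) (L : ℝ) (x₀ : Vec d) (h₀ : Fin N → Vec d) : ℝ :=
  (objective f x₀ - ⨅ x, objective f x)
    + (1 / L) * ((1 / (N : ℝ)) * ∑ i, ‖h₀ i - gradient (f i) x₀‖ ^ 2)

end Cofig

end

set_option linter.unusedSectionVars false

noncomputable section

namespace Cofig

open scoped RealInnerProductSpace

/-! Write q = 1 + ω, p = S / N, n = σ² / b, and let A be the mean of ‖∇f_i(x) - h_i‖². Since h is
the mean of the h_i, the estimate g is unbiased for ∇f(x). Sampling, compression and minibatches add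
at most (q / S)(A + n) to the second moment ‖∇f(x)‖² (`integral_norm_sq_gradEst_le`). By smoothness,
f then decreases in expectation by about η‖∇f(x)‖², up to η²(L / 2)(q / S)(A + n), so the task is to
control A.

The device is the virtual point w_i, the model at which the shift of client i was last updated; it
never influences the algorithm. It splits A into W, the mean of ‖x - w_i‖², and H, the mean of
‖∇f_i(w_i) - h_i‖² (`gradError_le`). In each round w_i is reset to x with probability p,
independently of g because the two sampled sets are independent. Hence W contracts by 1 - p/2 up to
terms of order η² (`pointError_step`). With α = 1 / q, H contracts by 1 - p and gains p((1 - 1/q)A +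
n/q) (`shiftError_step`). The joint law of u_i and v_i is never needed: H sees only u, while f and W
see only v, and expectations add.

The Lyapunov function f - f^* + c W + c_H H has weights for which all occurrences of A are paid for
by the two contractions. The first three bounds on the step size leave the gradient term the
coefficient -(13/20)η (`lyapunov_inequality`). Summing over rounds bounds the sum of E‖∇f(x^t)‖² by
the initial error over η plus a noise floor. The last bound on η keeps the floor below a fraction of
ε², and `one_le_stepSize_mul_rate` turns 1/η into the rate.

The telescoping is done with extended nonnegative integrals, so integrability of the iterates is a
consequence and not a prerequisite. -/

/-! ### Uniformly random sets of clients -/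

/-- The indicator, as a real number, that client `i` belongs to the set `A`. -/
def sel {N : ℕ} (i : Fin N) (A : Finset (Fin N)) : ℝ := if i ∈ A then 1 else 0

lemma sel_mul_self {N : ℕ} (i : Fin N) (A : Finset (Fin N)) : sel i A * sel i A = sel i A := by
  unfold sel; split_ifs <;> simp

lemma setOf_card_eq (N S : ℕ) :
    {A : Finset (Fin N) | A.card = S} = ↑(Finset.powersetCard S (Finset.univ : Finset (Fin N))) := by
  ext A; simp [Finset.mem_powersetCard]

lemma isProbabilityMeasure_clientLaw {N S : ℕ} (hSN : S ≤ N) :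
    IsProbabilityMeasure (clientLaw N S) := by
  unfold clientLaw
  rw [setOf_card_eq]
  refine isProbabilityMeasure_uniformOn (Finset.finite_toSet _) ?_
  rw [Finset.coe_nonempty, Finset.powersetCard_nonempty]
  simpa using hSN

/-- Used with one and with two clients, for the probabilities of inclusion and of joint inclusion.
-/
lemma clientLaw_real_superset {N S : ℕ} (s : Finset (Fin N)) (hs : s.card ≤ S) :
    (clientLaw N S).real {A | s ⊆ A} = ((N - s.card).choose (S - s.card) : ℝ) / N.choose S := by
  have h : {A : Finset (Fin N) | s ⊆ A} = ↑(Finset.univ.filter (fun A : Finset (Fin N) => s ⊆ A)) := by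
    ext; simp
  have h2 : Finset.powersetCard S (Finset.univ : Finset (Fin N)) ∩
      Finset.univ.filter (fun A : Finset (Fin N) => s ⊆ A) =
      (Finset.powersetCard S Finset.univ).filter (s ⊆ ·) := by
    ext; simp
  rw [Measure.real, clientLaw, setOf_card_eq, h, uniformOn_apply_finset, h2,
    Finset.card_filter_powersetCard_subset s Finset.univ S (Finset.subset_univ _) hs,
    Finset.card_powersetCard]
  simp

lemma integral_sel {N S : ℕ} (hS : 1 ≤ S) (hSN : S ≤ N) (i : Fin N) :
    ∫ A, sel i A ∂(clientLaw N S) = (S : ℝ) / N := by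
  have h1 : ∀ A : Finset (Fin N), sel i A = {A : Finset (Fin N) | {i} ⊆ A}.indicator 1 A := by
    intro A; simp [sel, Set.indicator_apply]
  simp_rw [h1]
  rw [integral_indicator_one (by measurability), clientLaw_real_superset _ (by simpa using hS)]
  obtain ⟨S, rfl⟩ := Nat.exists_eq_add_of_le' hS
  obtain ⟨N, rfl⟩ := Nat.exists_eq_add_of_le' (hS.trans hSN)
  have := Nat.add_one_mul_choose_eq N S
  have hpos : 0 < (N + 1).choose (S + 1) := Nat.choose_pos hSN
  simp only [Finset.card_singleton, Nat.add_sub_cancel]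
  rw [div_eq_div_iff (by positivity) (by positivity)]
  exact_mod_cast (by linarith : N.choose S * (N + 1) = (S + 1) * (N + 1).choose (S + 1))

/-- Sampling without replacement is negatively correlated: the joint inclusion probability S(S - 1)
/ (N(N - 1)) is at most (S / N)². It matters that one value `p₂ ≥ 0` serves all pairs, since the
off-diagonal terms can then be completed to a square. -/
lemma exists_integral_sel_mul_sel {N S : ℕ} (hS : 1 ≤ S) (hSN : S ≤ N) :
    ∃ p₂ : ℝ, 0 ≤ p₂ ∧ p₂ ≤ ((S : ℝ) / N) ^ 2 ∧ ∀ i j : Fin N, i ≠ j →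
      ∫ A, sel i A * sel j A ∂(clientLaw N S) = p₂ := by
  have h1 : ∀ (i j : Fin N) (A : Finset (Fin N)), sel i A * sel j A =
      {A : Finset (Fin N) | {i, j} ⊆ A}.indicator 1 A := by
    intro i j A
    simp only [sel, Set.indicator_apply, Set.mem_ofPred_eq, Finset.insert_subset_iff,
      Finset.singleton_subset_iff, Pi.one_apply]
    split_ifs <;> simp_all
  simp_rw [h1]
  simp_rw [integral_indicator_one (DiscreteMeasurableSpace.forall_measurableSet _)]
  -- For S = 1 no sampled set contains two clients. This case is separate because the truncated S -
  -- 2 would give a wrong count.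
  rcases Nat.lt_or_ge S 2 with hS2 | hS2
  · refine ⟨0, le_rfl, by positivity, fun i j hij => ?_⟩
    rw [Measure.real, clientLaw, (uniformOn_eq_zero_iff (Set.toFinite _)).2]
    · simp
    · ext A
      simp only [Set.mem_inter_iff, Set.mem_ofPred_eq, Set.mem_empty_iff_false, iff_false, not_and]
      intro hA hs
      have := Finset.card_le_card hs
      rw [Finset.card_pair hij] at this
      omega
  · refine ⟨((N - 2).choose (S - 2) : ℝ) / N.choose S, by positivity, ?_, fun i j hij => ?_⟩
    · obtain ⟨S, rfl⟩ := Nat.exists_eq_add_of_le' hS2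
      obtain ⟨N, rfl⟩ := Nat.exists_eq_add_of_le' (hS2.trans hSN)
      have e1 : (N + 1 + 1) * (N + 1).choose (S + 1) = (N + 2).choose (S + 2) * (S + 1 + 1) :=
        Nat.add_one_mul_choose_eq (N + 1) (S + 1)
      have e2 : (N + 1) * N.choose S = (N + 1).choose (S + 1) * (S + 1) :=
        Nat.add_one_mul_choose_eq N S
      have hpos : 0 < (N + 2).choose (S + 2) := Nat.choose_pos hSN
      have hle : (S : ℝ) ≤ N := by exact_mod_cast (by omega : S ≤ N)
      simp only [Nat.add_sub_cancel]
      have e1' : ((N : ℝ) + 2) * (N + 1).choose (S + 1) = (N + 2).choose (S + 2) * ((S : ℝ) + 2) := by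
        have := congrArg (Nat.cast (R := ℝ)) e1; push_cast at this; linarith
      have e2' : ((N : ℝ) + 1) * N.choose S = (N + 1).choose (S + 1) * ((S : ℝ) + 1) := by
        exact_mod_cast e2
      have hp : (0 : ℝ) < (N + 2).choose (S + 2) := by exact_mod_cast hpos
      have e3 : (N.choose S : ℝ) / (N + 2).choose (S + 2) =
          (((S : ℝ) + 2) / (N + 2)) * (((S : ℝ) + 1) / (N + 1)) := by
        rw [div_mul_div_comm, div_eq_div_iff (by positivity) (by positivity)]
        linear_combination ((N : ℝ) + 2) * e2' + ((S : ℝ) + 1) * e1'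
      -- With S and N shifted down by 2, what remains is (S + 1) / (N + 1) ≤ (S + 2) / (N + 2), that
      -- is, S ≤ N.
      rw [e3]
      push_cast
      rw [sq]
      refine mul_le_mul_of_nonneg_left ?_ (by positivity)
      rw [div_le_div_iff₀ (by positivity) (by positivity)]
      nlinarith
    · rw [clientLaw_real_superset _ (by rw [Finset.card_pair hij]; exact hS2), Finset.card_pair hij]

lemma integrable_clientLaw {N S : ℕ} (hSN : S ≤ N) (F : Finset (Fin N) → ℝ) :
    Integrable F (clientLaw N S) := by
  have := isProbabilityMeasure_clientLaw hSN
  exact Integrable.of_finite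

/-! ### Second moments of random vectors -/

section Moments

variable {E Θ : Type*} [NormedAddCommGroup E] [InnerProductSpace ℝ E] [MeasurableSpace Θ]
  {ρ : Measure Θ}

lemma integrable_inner_of_memLp {X Y : Θ → E} (hX : MemLp X 2 ρ) (hY : MemLp Y 2 ρ) :
    Integrable (fun θ => ⟪X θ, Y θ⟫) ρ := by
  have h := (hX.integrable_norm_pow two_ne_zero).add (hY.integrable_norm_pow two_ne_zero)
  refine h.mono' (hX.1.inner hY.1) (Filter.Eventually.of_forall fun θ => ?_)
  simp only [Pi.add_apply]
  have := norm_inner_le_norm (𝕜 := ℝ) (X θ) (Y θ)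
  nlinarith [sq_nonneg (‖X θ‖ - ‖Y θ‖), sq_nonneg ‖X θ‖, sq_nonneg ‖Y θ‖]

lemma integral_norm_add_const_sq [CompleteSpace E] [IsProbabilityMeasure ρ] {X : Θ → E}
    (hX : MemLp X 2 ρ) (c : E) :
    ∫ θ, ‖X θ + c‖ ^ 2 ∂ρ = ∫ θ, ‖X θ‖ ^ 2 ∂ρ + 2 * ⟪∫ θ, X θ ∂ρ, c⟫ + ‖c‖ ^ 2 := by
  have hi : Integrable X ρ := hX.integrable one_le_two
  have h1 : Integrable (fun θ => ⟪X θ, c⟫) ρ := hi.inner_const c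
  have h2 := hX.integrable_norm_pow two_ne_zero
  simp_rw [norm_add_sq_real]
  have h4 : Integrable (fun θ => ‖X θ‖ ^ 2 + 2 * ⟪X θ, c⟫) ρ := h2.add (h1.const_mul 2)
  rw [integral_add h4 (integrable_const _), integral_add h2 (h1.const_mul 2), integral_const_mul]
  have h3 : ∫ θ, ⟪X θ, c⟫ ∂ρ = ⟪∫ θ, X θ ∂ρ, c⟫ := by
    simp_rw [fun θ => real_inner_comm c (X θ)]
    rw [integral_inner hi, real_inner_comm]
  rw [h3]
  simp

/-- The second moment is the squared norm of the mean plus the variance. -/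
lemma integral_norm_sq_eq_variance_add [CompleteSpace E] [IsProbabilityMeasure ρ] {X : Θ → E}
    (hX : MemLp X 2 ρ) {m : E} (hm : ∫ θ, X θ ∂ρ = m) :
    ∫ θ, ‖X θ‖ ^ 2 ∂ρ = ‖m‖ ^ 2 + ∫ θ, ‖X θ - m‖ ^ 2 ∂ρ := by
  have h := integral_norm_add_const_sq hX (-m)
  simp only [← sub_eq_add_neg, hm, inner_neg_right, real_inner_self_eq_norm_sq, norm_neg] at h
  linarith

lemma memLp_two_of_integrable_norm_sub_sq [IsFiniteMeasure ρ] {X : Θ → E}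
    (hX : AEStronglyMeasurable X ρ) (c : E) (h : Integrable (fun θ => ‖X θ - c‖ ^ 2) ρ) :
    MemLp X 2 ρ := by
  have h1 : MemLp (fun θ => X θ - c) 2 ρ :=
    (memLp_two_iff_integrable_sq_norm (hX.sub aestronglyMeasurable_const)).2 h
  refine (h1.add (memLp_const c)).congr_norm hX (Filter.Eventually.of_forall fun θ => ?_)
  simp

lemma integral_norm_sum_sq {ι : Type*} [Fintype ι] {X : ι → Θ → E} (hX : ∀ i, MemLp (X i) 2 ρ) :
    ∫ θ, ‖∑ i, X i θ‖ ^ 2 ∂ρ = ∑ i, ∑ j, ∫ θ, ⟪X i θ, X j θ⟫ ∂ρ := by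
  simp_rw [← real_inner_self_eq_norm_sq, sum_inner, inner_sum]
  rw [integral_finsetSum _ fun i _ => integrable_finsetSum _ fun j _ =>
    integrable_inner_of_memLp (hX i) (hX j)]
  refine Finset.sum_congr rfl fun i _ => ?_
  rw [integral_finsetSum _ fun j _ => integrable_inner_of_memLp (hX i) (hX j)]

lemma integral_inner_of_indepFun [FiniteDimensional ℝ E] [MeasurableSpace E] [BorelSpace E]
    {X Y : Θ → E} (h : X ⟂ᵢ[ρ] Y) (hX : Integrable X ρ) (hY : Integrable Y ρ) :
    ∫ θ, ⟪X θ, Y θ⟫ ∂ρ = ⟪∫ θ, X θ ∂ρ, ∫ θ, Y θ ∂ρ⟫ := by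
  have := FiniteDimensional.complete ℝ E
  exact h.integral_bilin hX hY (innerSL ℝ)

end Moments

/-! ### Minibatches and messages -/

section Messages

variable {d N b : ℕ} {Z Ξ : Type*} [MeasurableSpace Z] [MeasurableSpace Ξ]

lemma memLp_minibatchGrad {Di : Measure Z} [IsProbabilityMeasure Di] {g : Vec d → Z → Vec d}
    {x : Vec d} (hg : MemLp (g x) 2 Di) :
    MemLp (minibatchGrad (b := b) g x) 2 (Measure.pi fun _ => Di) := by
  unfold minibatchGrad
  have hk : ∀ k ∈ (Finset.univ : Finset (Fin b)),
      MemLp (fun z : Fin b → Z => g x (z k)) 2 (Measure.pi fun _ => Di) :=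
    fun k _ => hg.comp_measurePreserving (measurePreserving_eval (fun _ => Di) k)
  exact (memLp_finsetSum _ hk).const_smul (1 / (b : ℝ))

lemma integral_minibatchGrad {Di : Measure Z} [IsProbabilityMeasure Di] (hb : 1 ≤ b)
    {g : Vec d → Z → Vec d} {x : Vec d} (hg : Integrable (g x) Di) :
    ∫ z, minibatchGrad (b := b) g x z ∂(Measure.pi fun _ => Di) = ∫ z, g x z ∂Di := by
  unfold minibatchGrad
  have hk : ∀ k : Fin b, Integrable (fun z : Fin b → Z => g x (z k)) (Measure.pi fun _ => Di) :=
    fun k => (measurePreserving_eval (fun _ => Di) k).integrable_comp_of_integrable hg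
  rw [integral_smul, integral_finsetSum _ fun k _ => hk k]
  have h : ∀ k : Fin b, ∫ z : Fin b → Z, g x (z k) ∂(Measure.pi fun _ => Di) = ∫ z, g x z ∂Di :=
    fun k => integral_comp_eval (μ := fun _ : Fin b => Di) (i := k) hg.1
  simp_rw [h]
  have hb' : (b : ℝ) ≠ 0 := by positivity
  rw [Finset.sum_const, Finset.card_univ, Fintype.card_fin, ← Nat.cast_smul_eq_nsmul ℝ, smul_smul,
    one_div_mul_cancel hb', one_smul]

/-- Independent centred samples are orthogonal in L², so of the b² inner products only the b
diagonal ones survive the factor 1 / b². -/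
lemma integral_minibatchGrad_sub_sq {Di : Measure Z} [IsProbabilityMeasure Di] (hb : 1 ≤ b)
    {g : Vec d → Z → Vec d} {x m : Vec d} (hg : MemLp (g x) 2 Di) (hm : ∫ z, g x z ∂Di = m) :
    ∫ z, ‖minibatchGrad (b := b) g x z - m‖ ^ 2 ∂(Measure.pi fun _ => Di) =
      (∫ z, ‖g x z - m‖ ^ 2 ∂Di) / b := by
  have hb' : (b : ℝ) ≠ 0 := by positivity
  set Y : Z → Vec d := fun z => g x z - m with hYdef
  have hY : MemLp Y 2 Di := hg.sub (memLp_const m)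
  have hY0 : ∫ z, Y z ∂Di = 0 := by
    rw [hYdef, integral_sub (hg.integrable one_le_two) (integrable_const _), hm]; simp
  have hrw : ∀ z : Fin b → Z, minibatchGrad g x z - m = (1 / (b : ℝ)) • ∑ k, Y (z k) := by
    intro z
    simp only [minibatchGrad, hYdef, Finset.sum_sub_distrib, Finset.sum_const, Finset.card_univ,
      Fintype.card_fin, smul_sub]
    rw [← Nat.cast_smul_eq_nsmul ℝ, smul_smul, one_div_mul_cancel hb', one_smul]
  have hYk : ∀ k : Fin b, MemLp (fun z : Fin b → Z => Y (z k)) 2 (Measure.pi fun _ => Di) :=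
    fun k => hY.comp_measurePreserving (measurePreserving_eval (fun _ => Di) k)
  have hind : iIndepFun (fun (k : Fin b) (z : Fin b → Z) => Y (z k)) (Measure.pi fun _ => Di) :=
    iIndepFun_pi fun _ => hY.1.aemeasurable
  have hY0k : ∀ k : Fin b, ∫ z : Fin b → Z, Y (z k) ∂(Measure.pi fun _ => Di) = 0 := fun k => by
    rw [integral_comp_eval (μ := fun _ : Fin b => Di) (i := k) hY.1, hY0]
  simp_rw [hrw, norm_smul, mul_pow]
  rw [integral_const_mul, integral_norm_sum_sq hYk]
  have hdiag : ∀ k l : Fin b, ∫ z : Fin b → Z, ⟪Y (z k), Y (z l)⟫ ∂(Measure.pi fun _ => Di) =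
      if k = l then ∫ z, ‖Y z‖ ^ 2 ∂Di else 0 := by
    intro k l
    split_ifs with hkl
    · subst hkl
      simp_rw [real_inner_self_eq_norm_sq]
      exact integral_comp_eval (μ := fun _ : Fin b => Di) (i := k) (f := fun z => ‖Y z‖ ^ 2)
        (hY.1.norm.pow 2)
    · rw [integral_inner_of_indepFun (hind.indepFun hkl) ((hYk k).integrable one_le_two)
        ((hYk l).integrable one_le_two), hY0k, inner_zero_left]
  simp_rw [hdiag]
  simp only [Finset.sum_ite_eq, Finset.mem_univ, if_true, Finset.sum_const, Finset.card_univ,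
    Fintype.card_fin, nsmul_eq_mul, Real.norm_eq_abs, sq_abs]
  rw [hYdef]
  field_simp

lemma IsCompressor.memLp {ν : Measure Ξ} [IsProbabilityMeasure ν] {C : Vec d → Ξ → Vec d} {ω : ℝ}
    (hC : IsCompressor ν C ω) (x : Vec d) : MemLp (C x) 2 ν :=
  memLp_two_of_integrable_norm_sub_sq
    (hC.measurable.comp measurable_prodMk_left).aestronglyMeasurable x (hC.integrable_sq x)

lemma IsCompressor.integral_norm_sq_le {ν : Measure Ξ} [IsProbabilityMeasure ν]
    {C : Vec d → Ξ → Vec d} {ω : ℝ} (hC : IsCompressor ν C ω) (x : Vec d) :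
    ∫ s, ‖C x s‖ ^ 2 ∂ν ≤ (1 + ω) * ‖x‖ ^ 2 := by
  rw [integral_norm_sq_eq_variance_add (hC.memLp x) (hC.unbiased x)]
  linarith [hC.variance_le x]

/-! ### Compression of a random vector by an independent seed. -/

section Compose

variable {Θ : Type*} [MeasurableSpace Θ] {ρ : Measure Θ} [IsFiniteMeasure ρ]
  {ν : Measure Ξ} [IsProbabilityMeasure ν] {C : Vec d → Ξ → Vec d} {ω : ℝ}

/-- Compressing a square integrable random vector with an independent compressor. -/
lemma IsCompressor.memLp_comp (hC : IsCompressor ν C ω) {Y : Θ → Vec d} (hYm : Measurable Y)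
    (hY : MemLp Y 2 ρ) : MemLp (fun p : Θ × Ξ => C (Y p.1) p.2) 2 (ρ.prod ν) := by
  have hm : Measurable fun p : Θ × Ξ => C (Y p.1) p.2 :=
    hC.measurable.comp ((hYm.comp measurable_fst).prodMk measurable_snd)
  rw [memLp_two_iff_integrable_sq_norm hm.aestronglyMeasurable]
  have hm2 : Measurable fun p : Θ × Ξ => ‖C (Y p.1) p.2‖ ^ 2 := hm.norm.pow_const 2
  -- Square integrability is checked fibrewise: for fixed θ the seed contributes at most (1 + ω)‖Y
  -- θ‖², which is integrable in θ.
  rw [integrable_prod_iff hm2.aestronglyMeasurable]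
  refine ⟨Filter.Eventually.of_forall fun θ =>
    (hC.memLp (Y θ)).integrable_norm_pow two_ne_zero, ?_⟩
  refine ((hY.integrable_norm_pow two_ne_zero).const_mul (1 + ω)).mono' ?_
    (Filter.Eventually.of_forall fun θ => ?_)
  · exact hm2.norm.stronglyMeasurable.integral_prod_right'.aestronglyMeasurable
  · rw [Real.norm_of_nonneg (integral_nonneg fun _ => norm_nonneg _)]
    simp only [norm_pow, norm_norm]
    exact hC.integral_norm_sq_le (Y θ)

lemma IsCompressor.integral_comp (hC : IsCompressor ν C ω) {Y : Θ → Vec d} (hYm : Measurable Y)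
    (hY : MemLp Y 2 ρ) : ∫ p, C (Y p.1) p.2 ∂(ρ.prod ν) = ∫ θ, Y θ ∂ρ := by
  rw [integral_prod _ ((hC.memLp_comp hYm hY).integrable one_le_two)]
  simp_rw [hC.unbiased]

lemma IsCompressor.integral_norm_sq_comp_le (hC : IsCompressor ν C ω) {Y : Θ → Vec d}
    (hYm : Measurable Y) (hY : MemLp Y 2 ρ) :
    ∫ p, ‖C (Y p.1) p.2‖ ^ 2 ∂(ρ.prod ν) ≤ (1 + ω) * ∫ θ, ‖Y θ‖ ^ 2 ∂ρ := by
  have hi := (hC.memLp_comp hYm hY).integrable_norm_pow two_ne_zero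
  rw [integral_prod _ hi, ← integral_const_mul]
  exact integral_mono hi.integral_prod_left ((hY.integrable_norm_pow two_ne_zero).const_mul _)
    fun θ => hC.integral_norm_sq_le (Y θ)

end Compose

/-- The message of a client with gradient oracle `g` and local shift `h`, as a function of the
minibatch and the compressor seed. -/
def message (g : Vec d → Z → Vec d) (C : Vec d → Ξ → Vec d) (x h : Vec d)
    (p : (Fin b → Z) × Ξ) : Vec d :=
  C (minibatchGrad g x p.1 - h) p.2

lemma measurable_minibatchGrad {g : Vec d → Z → Vec d}
    (hg : Measurable fun q : Vec d × Z => g q.1 q.2) :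
    Measurable fun q : Vec d × (Fin b → Z) => minibatchGrad g q.1 q.2 := by
  unfold minibatchGrad
  have hk : ∀ k ∈ (Finset.univ : Finset (Fin b)),
      Measurable fun q : Vec d × (Fin b → Z) => g q.1 (q.2 k) :=
    fun k _ => hg.comp (measurable_fst.prodMk ((measurable_pi_apply k).comp measurable_snd))
  exact (Finset.measurable_sum _ hk).const_smul (1 / (b : ℝ))

section Law

variable {f : Fin N → Vec d → ℝ} {D : Fin N → Measure Z} [∀ i, IsProbabilityMeasure (D i)]
  {G : Fin N → Vec d → Z → Vec d} {σ : ℝ}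
  {ν : Measure Ξ} [IsProbabilityMeasure ν] {C : Vec d → Ξ → Vec d} {ω : ℝ}

lemma IsStochasticGradient.memLp (hG : IsStochasticGradient f D G σ) (i : Fin N) (x : Vec d) :
    MemLp (G i x) 2 (D i) :=
  memLp_two_of_integrable_norm_sub_sq
    ((hG.measurable i).comp measurable_prodMk_left).aestronglyMeasurable _ (hG.integrable_sq i x)

lemma measurable_minibatchGrad_sub (hG : IsStochasticGradient f D G σ) (i : Fin N)
    (x h : Vec d) : Measurable fun z : Fin b → Z => minibatchGrad (G i) x z - h :=
  ((measurable_minibatchGrad (hG.measurable i)).comp measurable_prodMk_left).sub_const h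

lemma memLp_minibatchGrad_sub (hG : IsStochasticGradient f D G σ) (i : Fin N)
    (x h : Vec d) : MemLp (fun z : Fin b → Z => minibatchGrad (G i) x z - h) 2
      (Measure.pi fun _ => D i) :=
  (memLp_minibatchGrad (hG.memLp i x)).sub (memLp_const h)

lemma integral_minibatchGrad_sub (hb : 1 ≤ b) (hG : IsStochasticGradient f D G σ) (i : Fin N)
    (x h : Vec d) : ∫ z : Fin b → Z, (minibatchGrad (G i) x z - h) ∂(Measure.pi fun _ => D i) =
      gradient (f i) x - h := by
  rw [integral_sub ((memLp_minibatchGrad (hG.memLp i x)).integrable one_le_two)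
    (integrable_const _), integral_minibatchGrad hb ((hG.memLp i x).integrable one_le_two),
    hG.unbiased]
  simp

lemma integral_norm_sq_minibatchGrad_sub_le (hb : 1 ≤ b) (hG : IsStochasticGradient f D G σ)
    (i : Fin N) (x h : Vec d) :
    ∫ z : Fin b → Z, ‖minibatchGrad (G i) x z - h‖ ^ 2 ∂(Measure.pi fun _ => D i) ≤
      ‖gradient (f i) x - h‖ ^ 2 + σ ^ 2 / b := by
  rw [integral_norm_sq_eq_variance_add (memLp_minibatchGrad_sub hG i x h)
    (integral_minibatchGrad_sub hb hG i x h)]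
  simp only [sub_sub_sub_cancel_right]
  rw [integral_minibatchGrad_sub_sq hb (hG.memLp i x) (hG.unbiased i x)]
  gcongr
  exact hG.variance_le i x

lemma measurable_message (hG : IsStochasticGradient f D G σ) (hC : IsCompressor ν C ω)
    (i : Fin N) (x h : Vec d) : Measurable (message (b := b) (G i) C x h) :=
  hC.measurable.comp
    (((measurable_minibatchGrad_sub hG i x h).comp measurable_fst).prodMk measurable_snd)

lemma memLp_message (hG : IsStochasticGradient f D G σ) (hC : IsCompressor ν C ω)
    (i : Fin N) (x h : Vec d) :
    MemLp (message (b := b) (G i) C x h) 2 ((Measure.pi fun _ => D i).prod ν) :=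
  hC.memLp_comp (measurable_minibatchGrad_sub hG i x h) (memLp_minibatchGrad_sub hG i x h)

lemma integral_message (hb : 1 ≤ b) (hG : IsStochasticGradient f D G σ)
    (hC : IsCompressor ν C ω) (i : Fin N) (x h : Vec d) :
    ∫ p, message (b := b) (G i) C x h p ∂((Measure.pi fun _ => D i).prod ν) =
      gradient (f i) x - h :=
  (hC.integral_comp (measurable_minibatchGrad_sub hG i x h)
    (memLp_minibatchGrad_sub hG i x h)).trans (integral_minibatchGrad_sub hb hG i x h)

lemma integral_norm_sq_message_le (hb : 1 ≤ b) (hω : 0 ≤ ω) (hG : IsStochasticGradient f D G σ)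
    (hC : IsCompressor ν C ω) (i : Fin N) (x h : Vec d) :
    ∫ p, ‖message (b := b) (G i) C x h p‖ ^ 2 ∂((Measure.pi fun _ => D i).prod ν) ≤
      (1 + ω) * (‖gradient (f i) x - h‖ ^ 2 + σ ^ 2 / b) :=
  (hC.integral_norm_sq_comp_le (measurable_minibatchGrad_sub hG i x h)
    (memLp_minibatchGrad_sub hG i x h)).trans
    (mul_le_mul_of_nonneg_left (integral_norm_sq_minibatchGrad_sub_le hb hG i x h) (by positivity))

/-- The projections of the noise of a client to the parts used for its two messages. -/
lemma measurePreserving_noise_fst {Di : Measure Z} {κi : Measure ((Fin b → Z) × (Fin b → Z))}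
    [IsProbabilityMeasure Di] [SFinite κi] (hκ : IsMinibatchPairLaw Di κi) :
    MeasurePreserving (fun c : ClientNoise b Z Ξ => (c.1.1, c.2.1)) (κi.prod (ν.prod ν))
      ((Measure.pi fun _ => Di).prod ν) :=
  MeasurePreserving.prod ⟨measurable_fst, hκ.map_fst⟩ measurePreserving_fst

lemma measurePreserving_noise_snd {Di : Measure Z} {κi : Measure ((Fin b → Z) × (Fin b → Z))}
    [IsProbabilityMeasure Di] [SFinite κi] (hκ : IsMinibatchPairLaw Di κi) :
    MeasurePreserving (fun c : ClientNoise b Z Ξ => (c.1.2, c.2.2)) (κi.prod (ν.prod ν))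
      ((Measure.pi fun _ => Di).prod ν) :=
  MeasurePreserving.prod ⟨measurable_snd, hκ.map_snd⟩ measurePreserving_snd

/-- The coupling has the total mass of its marginals. -/
lemma IsMinibatchPairLaw.isProbabilityMeasure {Di : Measure Z} [IsProbabilityMeasure Di]
    {κi : Measure ((Fin b → Z) × (Fin b → Z))} (hκ : IsMinibatchPairLaw Di κi) :
    IsProbabilityMeasure κi := by
  refine ⟨?_⟩
  have h : (κi.map Prod.fst) Set.univ = 1 := by rw [hκ.map_fst]; exact measure_univ
  rwa [Measure.map_apply measurable_fst MeasurableSet.univ, Set.preimage_univ] at h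

end Law
end Messages

/-! ### Sampling clients without replacement -/

section Sampling

variable {E Θ : Type*} [NormedAddCommGroup E] [InnerProductSpace ℝ E] [CompleteSpace E]
  [MeasurableSpace Θ] {ρ : Measure Θ} [IsProbabilityMeasure ρ] {N S : ℕ}

/-- The sum, over the clients in a set, of their random vectors. -/
def sampledSum (X : Fin N → Θ → E) (p : Finset (Fin N) × Θ) : E := ∑ i ∈ p.1, X i p.2

lemma sampledSum_eq (X : Fin N → Θ → E) (p : Finset (Fin N) × Θ) :
    sampledSum X p = ∑ i, sel i p.1 • X i p.2 := by
  simp [sampledSum, sel, ite_smul, Finset.sum_ite_mem]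

lemma memLp_sel_smul (hSN : S ≤ N) {X : Θ → E} (hX : MemLp X 2 ρ) (i : Fin N) :
    MemLp (fun p : Finset (Fin N) × Θ => sel i p.1 • X p.2) 2 ((clientLaw N S).prod ρ) := by
  have := isProbabilityMeasure_clientLaw hSN
  have h : MemLp (fun p : Finset (Fin N) × Θ => X p.2) 2 ((clientLaw N S).prod ρ) :=
    hX.comp_measurePreserving measurePreserving_snd
  have hs : Measurable fun p : Finset (Fin N) × Θ => sel i p.1 :=
    (measurable_of_countable (sel i)).comp measurable_fst
  refine h.mono (hs.aestronglyMeasurable.smul h.1) (Filter.Eventually.of_forall fun p => ?_)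
  unfold sel; split_ifs <;> simp

lemma memLp_sampledSum (hSN : S ≤ N) {X : Fin N → Θ → E} (hX : ∀ i, MemLp (X i) 2 ρ) :
    MemLp (sampledSum X) 2 ((clientLaw N S).prod ρ) := by
  rw [show sampledSum X = fun p => ∑ i, sel i p.1 • X i p.2 from funext (sampledSum_eq X)]
  exact memLp_finsetSum _ fun i _ => memLp_sel_smul hSN (hX i) i

lemma integral_sampledSum (hS : 1 ≤ S) (hSN : S ≤ N) {X : Fin N → Θ → E}
    (hX : ∀ i, MemLp (X i) 2 ρ) :
    ∫ p, sampledSum X p ∂((clientLaw N S).prod ρ) = ((S : ℝ) / N) • ∑ i, ∫ θ, X i θ ∂ρ := by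
  have := isProbabilityMeasure_clientLaw hSN
  simp_rw [sampledSum_eq]
  rw [integral_finsetSum _ fun i _ => (memLp_sel_smul hSN (hX i) i).integrable one_le_two,
    Finset.smul_sum]
  refine Finset.sum_congr rfl fun i _ => ?_
  rw [integral_prod_smul (fun A => sel i A) (X i), integral_sel hS hSN]

/-- The pairs i ≠ j contribute `p₂` times the inner product of the means. Adding the nonnegative
diagonal terms `p₂ * ‖a i‖ ^ 2` completes them to `p₂ * ‖∑ i, a i‖ ^ 2`, and only then may `p₂` be
replaced by its upper bound (S / N)², since single inner products have no sign. -/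
lemma integral_norm_sq_sampledSum_le (hS : 1 ≤ S) (hSN : S ≤ N) {X : Fin N → Θ → E}
    (hX : ∀ i, MemLp (X i) 2 ρ)
    (hXX : ∀ i j, i ≠ j → ∫ θ, ⟪X i θ, X j θ⟫ ∂ρ = ⟪∫ θ, X i θ ∂ρ, ∫ θ, X j θ ∂ρ⟫) :
    ∫ p, ‖sampledSum X p‖ ^ 2 ∂((clientLaw N S).prod ρ) ≤
      (S : ℝ) / N * ∑ i, ∫ θ, ‖X i θ‖ ^ 2 ∂ρ + ((S : ℝ) / N) ^ 2 * ‖∑ i, ∫ θ, X i θ ∂ρ‖ ^ 2 := by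
  have := isProbabilityMeasure_clientLaw hSN
  obtain ⟨p₂, hp0, hp2, hp⟩ := exists_integral_sel_mul_sel (N := N) hS hSN
  simp_rw [sampledSum_eq]
  rw [integral_norm_sum_sq fun i => memLp_sel_smul hSN (hX i) i]
  set a : Fin N → E := fun i => ∫ θ, X i θ ∂ρ with ha
  have hterm : ∀ i j, ∫ p : Finset (Fin N) × Θ, ⟪sel i p.1 • X i p.2, sel j p.1 • X j p.2⟫
      ∂((clientLaw N S).prod ρ) ≤
      p₂ * ⟪a i, a j⟫ + if i = j then (S : ℝ) / N * ∫ θ, ‖X i θ‖ ^ 2 ∂ρ else 0 := by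
    intro i j
    have hrw : ∀ p : Finset (Fin N) × Θ, ⟪sel i p.1 • X i p.2, sel j p.1 • X j p.2⟫ =
        (sel i p.1 * sel j p.1) * ⟪X i p.2, X j p.2⟫ := by
      intro p
      rw [real_inner_smul_left, real_inner_smul_right, mul_assoc]
    simp_rw [hrw]
    rw [integral_prod_mul (fun A => sel i A * sel j A) fun θ => ⟪X i θ, X j θ⟫]
    split_ifs with hij
    · subst hij
      simp_rw [sel_mul_self, real_inner_self_eq_norm_sq]
      rw [integral_sel hS hSN]
      have : 0 ≤ p₂ * ‖a i‖ ^ 2 := by positivity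
      linarith
    · rw [hp i j hij, hXX i j hij, add_zero]
  refine (Finset.sum_le_sum fun i _ => Finset.sum_le_sum fun j _ => hterm i j).trans ?_
  simp only [Finset.sum_add_distrib, Finset.sum_ite_eq, Finset.mem_univ, if_true,
    ← Finset.mul_sum]
  have h2 : ∑ i, ∑ j, ⟪a i, a j⟫ = ‖∑ i, a i‖ ^ 2 := by
    rw [← real_inner_self_eq_norm_sq, sum_inner]
    simp_rw [inner_sum]
  rw [h2]
  nlinarith [mul_le_mul_of_nonneg_right hp2 (sq_nonneg ‖∑ i, a i‖)]

/-- The second moment of an average over sampled clients, shifted by a constant. -/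
lemma integral_norm_sq_sampled_average_le (hS : 1 ≤ S) (hSN : S ≤ N) {X : Fin N → Θ → E}
    (hX : ∀ i, MemLp (X i) 2 ρ)
    (hXX : ∀ i j, i ≠ j → ∫ θ, ⟪X i θ, X j θ⟫ ∂ρ = ⟪∫ θ, X i θ ∂ρ, ∫ θ, X j θ ∂ρ⟫) (c : E) :
    ∫ p, ‖(1 / (S : ℝ)) • sampledSum X p + c‖ ^ 2 ∂((clientLaw N S).prod ρ) ≤
      ‖(1 / (N : ℝ)) • ∑ i, (∫ θ, X i θ ∂ρ) + c‖ ^ 2 +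
        1 / ((S : ℝ) * N) * ∑ i, ∫ θ, ‖X i θ‖ ^ 2 ∂ρ := by
  have := isProbabilityMeasure_clientLaw hSN
  have hS0 : (0 : ℝ) < S := by exact_mod_cast hS
  have hN0 : (0 : ℝ) < N := by exact_mod_cast hS.trans hSN
  have hL : MemLp (fun p => (1 / (S : ℝ)) • sampledSum X p) 2 ((clientLaw N S).prod ρ) :=
    (memLp_sampledSum hSN hX).const_smul (1 / (S : ℝ))
  rw [integral_norm_add_const_sq hL, norm_add_sq_real]
  simp_rw [norm_smul, mul_pow]
  rw [integral_const_mul, integral_smul, integral_sampledSum hS hSN hX, smul_smul,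
    one_div_mul_eq_div, div_div_cancel_left' hS0.ne', one_div (N : ℝ)]
  have h := mul_le_mul_of_nonneg_left (integral_norm_sq_sampledSum_le hS hSN hX hXX)
    (by positivity : 0 ≤ ‖1 / (S : ℝ)‖ ^ 2)
  -- Because (1/S)(S/N) = 1/N, the last term is exactly the squared mean, and it joins the cross
  -- term with c to form ‖mean + c‖².
  have e : ‖1 / (S : ℝ)‖ ^ 2 * ((S : ℝ) / N * ∑ i, ∫ θ, ‖X i θ‖ ^ 2 ∂ρ +
      ((S : ℝ) / N) ^ 2 * ‖∑ i, ∫ θ, X i θ ∂ρ‖ ^ 2) =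
      1 / ((S : ℝ) * N) * ∑ i, ∫ θ, ‖X i θ‖ ^ 2 ∂ρ +
        ‖(N : ℝ)⁻¹‖ ^ 2 * ‖∑ i, ∫ θ, X i θ ∂ρ‖ ^ 2 := by
    rw [Real.norm_of_nonneg (by positivity), Real.norm_of_nonneg (by positivity)]
    field_simp
  linarith

lemma integral_sampled_average (hS : 1 ≤ S) (hSN : S ≤ N) {X : Fin N → Θ → E}
    (hX : ∀ i, MemLp (X i) 2 ρ) (c : E) :
    ∫ p, ((1 / (S : ℝ)) • sampledSum X p + c) ∂((clientLaw N S).prod ρ) =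
      (1 / (N : ℝ)) • ∑ i, (∫ θ, X i θ ∂ρ) + c := by
  have := isProbabilityMeasure_clientLaw hSN
  have hS0 : (S : ℝ) ≠ 0 := by positivity
  have hi : Integrable (fun p => (1 / (S : ℝ)) • sampledSum X p) ((clientLaw N S).prod ρ) :=
    ((memLp_sampledSum hSN hX).integrable one_le_two).smul (1 / (S : ℝ))
  rw [integral_add hi (integrable_const _), integral_smul,
    integral_sampledSum hS hSN hX, smul_smul, one_div_mul_eq_div, div_div_cancel_left' hS0, one_div]
  simp

/-- Rounds in which the first sampled set does or does not contain the client `i`. -/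
lemma integral_sel_mix (hS : 1 ≤ S) (hSN : S ≤ N) (i : Fin N)
    {φ ψ : Finset (Fin N) × Θ → ℝ} (hφ : Integrable φ ((clientLaw N S).prod ρ))
    (hψ : Integrable ψ ((clientLaw N S).prod ρ)) :
    Integrable (fun r : (Finset (Fin N) × Finset (Fin N)) × Θ =>
        if i ∈ r.1.1 then φ (r.1.2, r.2) else ψ (r.1.2, r.2))
      (((clientLaw N S).prod (clientLaw N S)).prod ρ) ∧
    ∫ r, (if i ∈ r.1.1 then φ (r.1.2, r.2) else ψ (r.1.2, r.2))
      ∂(((clientLaw N S).prod (clientLaw N S)).prod ρ) =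
      (S : ℝ) / N * ∫ p, φ p ∂((clientLaw N S).prod ρ) +
        (1 - (S : ℝ) / N) * ∫ p, ψ p ∂((clientLaw N S).prod ρ) := by
  have := isProbabilityMeasure_clientLaw hSN
  set P := clientLaw N S
  -- Reassociation isolates the first sampled set as an independent factor. The integrand is then a
  -- sum of two products, one factor of each depending on that set only.
  have hmp : MeasurePreserving (MeasurableEquiv.prodAssoc :
      (Finset (Fin N) × Finset (Fin N)) × Θ ≃ᵐ _) ((P.prod P).prod ρ) (P.prod (P.prod ρ)) :=
    measurePreserving_prodAssoc P P ρ
  set F : Finset (Fin N) × (Finset (Fin N) × Θ) → ℝ :=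
    fun q => sel i q.1 * φ q.2 + (1 - sel i q.1) * ψ q.2 with hF
  have hrw : (fun r : (Finset (Fin N) × Finset (Fin N)) × Θ =>
      if i ∈ r.1.1 then φ (r.1.2, r.2) else ψ (r.1.2, r.2)) =
      fun r => F (MeasurableEquiv.prodAssoc r) := by
    funext r
    simp only [hF, sel, MeasurableEquiv.prodAssoc, MeasurableEquiv.coe_mk, Equiv.prodAssoc_apply]
    split_ifs <;> simp
  have h1 : Integrable (fun q : Finset (Fin N) × (Finset (Fin N) × Θ) => sel i q.1 * φ q.2)
      (P.prod (P.prod ρ)) := (integrable_clientLaw hSN (sel i)).mul_prod hφ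
  have h2 : Integrable (fun q : Finset (Fin N) × (Finset (Fin N) × Θ) => (1 - sel i q.1) * ψ q.2)
      (P.prod (P.prod ρ)) := (integrable_clientLaw hSN (fun A => 1 - sel i A)).mul_prod hψ
  have h12 : Integrable F (P.prod (P.prod ρ)) := h1.add h2
  rw [hrw]
  refine ⟨hmp.integrable_comp_of_integrable h12, ?_⟩
  rw [hmp.integral_comp' F, hF, integral_add h1 h2, integral_prod_mul (fun A => sel i A) φ,
    integral_prod_mul (fun A => 1 - sel i A) ψ, integral_sel hS hSN,
    integral_sub (integrable_const _) (integrable_clientLaw hSN _), integral_sel hS hSN]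
  simp

end Sampling

/-! ### Smoothness -/

section Smooth

/-- The quadratic upper bound for a function with Lipschitz gradient. -/
lemma le_quadratic_of_lipschitz_gradient {E : Type*} [NormedAddCommGroup E]
    [InnerProductSpace ℝ E] [CompleteSpace E] {φ : E → ℝ} {L : ℝ} (hd : Differentiable ℝ φ)
    (hL : ∀ x y, ‖gradient φ x - gradient φ y‖ ≤ L * ‖x - y‖) (x v : E) :
    φ (x + v) ≤ φ x + ⟪gradient φ x, v⟫ + L / 2 * ‖v‖ ^ 2 := by
  have hline : ∀ t : ℝ, HasDerivAt (fun t : ℝ => x + t • v) v t := fun t => by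
    simpa using ((hasDerivAt_id t).smul_const v).const_add x
  have h1 : ∀ t : ℝ, HasDerivAt (fun t : ℝ => φ (x + t • v)) ⟪gradient φ (x + t • v), v⟫ t := by
    intro t
    have h := (hd (x + t • v)).hasGradientAt.hasFDerivAt.comp_hasDerivAt t (hline t)
    exact h.congr_deriv (by simp)
  have h2 : ∀ t : ℝ, HasDerivAt (fun t : ℝ => φ x + t * ⟪gradient φ x, v⟫ + L / 2 * ‖v‖ ^ 2 * t ^ 2)
      (⟪gradient φ x, v⟫ + L * ‖v‖ ^ 2 * t) t := by
    intro t
    have ha := ((hasDerivAt_id t).mul_const ⟪gradient φ x, v⟫).const_add (φ x)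
    have hb := (hasDerivAt_pow 2 t).const_mul (L / 2 * ‖v‖ ^ 2)
    refine (ha.add hb).congr_deriv ?_
    norm_num
    ring
  -- Along the segment both sides agree at t = 0 and their derivatives are ordered on [0, 1), so
  -- they are ordered at t = 1.
  have key := image_le_of_deriv_right_le_deriv_boundary (a := 0) (b := 1)
    (fun t _ => (h1 t).continuousAt.continuousWithinAt) (fun t _ => (h1 t).hasDerivWithinAt)
    (B := fun t : ℝ => φ x + t * ⟪gradient φ x, v⟫ + L / 2 * ‖v‖ ^ 2 * t ^ 2) (by simp)
    (fun t _ => (h2 t).continuousAt.continuousWithinAt) (fun t _ => (h2 t).hasDerivWithinAt)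
    (fun t ht => ?_) (Set.right_mem_Icc.2 zero_le_one)
  · simpa using key
  · have hsub : ⟪gradient φ (x + t • v) - gradient φ x, v⟫ ≤ L * ‖v‖ ^ 2 * t := by
      refine (real_inner_le_norm _ _).trans ?_
      have := mul_le_mul_of_nonneg_right (hL (x + t • v) x) (norm_nonneg v)
      rw [add_sub_cancel_left, norm_smul, Real.norm_of_nonneg ht.1] at this
      linarith
    rw [inner_sub_left] at hsub
    linarith

variable {d N : ℕ} {f : Fin N → Vec d → ℝ} {L : ℝ}

lemma IsSmooth.hasGradientAt_objective (hf : IsSmooth f L) (x : Vec d) :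
    HasGradientAt (objective f) ((1 / (N : ℝ)) • ∑ i, gradient (f i) x) x := by
  rw [hasGradientAt_iff_hasFDerivAt, map_smul, map_sum]
  exact (HasFDerivAt.fun_sum fun i _ => ((hf i).1 x).hasGradientAt.hasFDerivAt).const_mul
    (1 / (N : ℝ))

lemma IsSmooth.gradient_objective (hf : IsSmooth f L) (x : Vec d) :
    gradient (objective f) x = (1 / (N : ℝ)) • ∑ i, gradient (f i) x :=
  (hf.hasGradientAt_objective x).gradient

lemma IsSmooth.differentiable_objective (hf : IsSmooth f L) : Differentiable ℝ (objective f) :=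
  fun x => (hf.hasGradientAt_objective x).differentiableAt

lemma IsSmooth.gradient_objective_lipschitz (hf : IsSmooth f L) (hN : 1 ≤ N) (x y : Vec d) :
    ‖gradient (objective f) x - gradient (objective f) y‖ ≤ L * ‖x - y‖ := by
  have hN0 : (0 : ℝ) < N := by exact_mod_cast hN
  rw [hf.gradient_objective, hf.gradient_objective, ← smul_sub, ← Finset.sum_sub_distrib, norm_smul,
    Real.norm_of_nonneg (by positivity), one_div, inv_mul_le_iff₀ hN0]
  refine (norm_sum_le_of_le _ fun i _ => (hf i).2 x y).trans ?_
  simp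

lemma IsSmooth.objective_le (hf : IsSmooth f L) (hN : 1 ≤ N) (x v : Vec d) :
    objective f (x + v) ≤
      objective f x + ⟪gradient (objective f) x, v⟫ + L / 2 * ‖v‖ ^ 2 :=
  le_quadratic_of_lipschitz_gradient hf.differentiable_objective
    (hf.gradient_objective_lipschitz hN) x v

lemma IsSmooth.continuous_gradient (hf : IsSmooth f L) (hL : 0 ≤ L) (i : Fin N) :
    Continuous (gradient (f i)) := by
  refine (LipschitzWith.of_dist_le_mul (K := ⟨L, hL⟩) fun x y => ?_).continuous
  rw [dist_eq_norm, dist_eq_norm]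
  exact (hf i).2 x y

lemma IsSmooth.continuous_gradient_objective (hf : IsSmooth f L) (hL : 0 ≤ L) :
    Continuous (gradient (objective f)) := by
  rw [show gradient (objective f) = fun x => (1 / (N : ℝ)) • ∑ i, gradient (f i) x from
    funext hf.gradient_objective]
  exact (continuous_finsetSum _ fun i _ => hf.continuous_gradient hL i).const_smul (1 / (N : ℝ))

end Smooth

/-! ### The error terms -/

section Errors

variable {d N : ℕ}

/-- The mean of the squared norms of the vectors `v i`. -/
def meanSq (v : Fin N → Vec d) : ℝ := (1 / (N : ℝ)) * ∑ i, ‖v i‖ ^ 2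

lemma meanSq_nonneg (v : Fin N → Vec d) : 0 ≤ meanSq v := by unfold meanSq; positivity

/-- The distance of the model to the virtual points. -/
def pointError (s : State d N) : ℝ := meanSq fun i => s.x - s.w i

/-- The distance of the local shifts to the gradients at the virtual points. -/
def shiftError (f : Fin N → Vec d → ℝ) (s : State d N) : ℝ :=
  meanSq fun i => gradient (f i) (s.w i) - s.hloc i

/-- The distance of the local shifts to the gradients at the model. -/
def gradError (f : Fin N → Vec d → ℝ) (s : State d N) : ℝ :=
  meanSq fun i => gradient (f i) s.x - s.hloc i

/-- Young's inequality with a free parameter; the defect is the square (s y - z)² / s. -/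
lemma norm_sq_le_of_norm_le_add {x y z s : ℝ} (hx : 0 ≤ x) (hs : 0 < s) (h : x ≤ y + z) :
    x ^ 2 ≤ (1 + s) * y ^ 2 + (1 + 1 / s) * z ^ 2 := by
  have h1 : x ^ 2 ≤ (y + z) ^ 2 := by gcongr
  have h2 : (1 + s) * y ^ 2 + (1 + 1 / s) * z ^ 2 - (y + z) ^ 2 = (s * y - z) ^ 2 / s := by
    field_simp; ring
  have h3 : 0 ≤ (s * y - z) ^ 2 / s := by positivity
  linarith

/-- The triangle inequality through ∇f_i(w_i), followed by Young's inequality with parameter 2q - 1.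
This choice makes the coefficient of `shiftError` cancel exactly in `lyapunov_inequality`. -/
lemma gradError_le {f : Fin N → Vec d → ℝ} {L : ℝ} (hf : IsSmooth f L) {q : ℝ}
    (hq : 1 ≤ q) (s : State d N) :
    gradError f s ≤ 2 * q * (L ^ 2 * pointError s) + 2 * q / (2 * q - 1) * shiftError f s := by
  have hq1 : 0 < 2 * q - 1 := by linarith
  have key : ∀ i, ‖gradient (f i) s.x - s.hloc i‖ ^ 2 ≤
      2 * q * (L ^ 2 * ‖s.x - s.w i‖ ^ 2) +
        2 * q / (2 * q - 1) * ‖gradient (f i) (s.w i) - s.hloc i‖ ^ 2 := by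
    intro i
    have h1 : ‖gradient (f i) s.x - s.hloc i‖ ≤
        L * ‖s.x - s.w i‖ + ‖gradient (f i) (s.w i) - s.hloc i‖ :=
      (norm_sub_le_norm_sub_add_norm_sub _ (gradient (f i) (s.w i)) _).trans
        (add_le_add_left ((hf i).2 _ _) _)
    have h2 := norm_sq_le_of_norm_le_add (norm_nonneg _) hq1 h1
    rw [mul_pow] at h2
    have e : 1 + 1 / (2 * q - 1) = 2 * q / (2 * q - 1) := by field_simp; ring
    rw [e] at h2
    linarith
  have h := mul_le_mul_of_nonneg_left (Finset.sum_le_sum fun i (_ : i ∈ Finset.univ) => key i)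
    (by positivity : 0 ≤ 1 / (N : ℝ))
  rw [Finset.sum_add_distrib, ← Finset.mul_sum, ← Finset.mul_sum, ← Finset.mul_sum] at h
  unfold gradError pointError shiftError meanSq
  linarith

end Errors

/-! ### The expected effect of one round -/

section Round

variable {d N S b : ℕ} {Z Ξ : Type*} [MeasurableSpace Z] [MeasurableSpace Ξ]
  {f : Fin N → Vec d → ℝ} {D : Fin N → Measure Z} [∀ i, IsProbabilityMeasure (D i)]
  {G : Fin N → Vec d → Z → Vec d} {σ : ℝ}
  {ν : Measure Ξ} [IsProbabilityMeasure ν] {C : Vec d → Ξ → Vec d} {ω : ℝ}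
  {κ : Fin N → Measure ((Fin b → Z) × (Fin b → Z))}

/-- The law of the noise of all clients in one round. -/
def noiseLaw (κ : Fin N → Measure ((Fin b → Z) × (Fin b → Z))) (ν : Measure Ξ) :
    Measure (Fin N → ClientNoise b Z Ξ) :=
  Measure.pi fun i => (κ i).prod (ν.prod ν)

lemma isProbabilityMeasure_noiseLaw (hκ : ∀ i, IsMinibatchPairLaw (D i) (κ i)) :
    IsProbabilityMeasure (noiseLaw κ ν) := by
  have := fun i => (hκ i).isProbabilityMeasure
  unfold noiseLaw
  infer_instance

lemma isProbabilityMeasure_roundLaw (hSN : S ≤ N) (hκ : ∀ i, IsMinibatchPairLaw (D i) (κ i)) :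
    IsProbabilityMeasure (roundLaw S κ ν) := by
  have := isProbabilityMeasure_clientLaw hSN
  have := isProbabilityMeasure_noiseLaw (ν := ν) hκ
  unfold noiseLaw at this
  unfold roundLaw
  infer_instance

/-- The part of the noise that is used for the message `u i`. -/
def noiseU (i : Fin N) (θ : Fin N → ClientNoise b Z Ξ) : (Fin b → Z) × Ξ := ((θ i).1.1, (θ i).2.1)

/-- The part of the noise that is used for the message `v i`. -/
def noiseV (i : Fin N) (θ : Fin N → ClientNoise b Z Ξ) : (Fin b → Z) × Ξ := ((θ i).1.2, (θ i).2.2)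

lemma measurePreserving_noiseU (hκ : ∀ i, IsMinibatchPairLaw (D i) (κ i)) (i : Fin N) :
    MeasurePreserving (noiseU i) (noiseLaw κ ν) ((Measure.pi fun _ => D i).prod ν) := by
  have := fun i => (hκ i).isProbabilityMeasure
  exact (measurePreserving_noise_fst (ν := ν) (hκ i)).comp
    (measurePreserving_eval (fun i => (κ i).prod (ν.prod ν)) i)

lemma measurePreserving_noiseV (hκ : ∀ i, IsMinibatchPairLaw (D i) (κ i)) (i : Fin N) :
    MeasurePreserving (noiseV i) (noiseLaw κ ν) ((Measure.pi fun _ => D i).prod ν) := by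
  have := fun i => (hκ i).isProbabilityMeasure
  exact (measurePreserving_noise_snd (ν := ν) (hκ i)).comp
    (measurePreserving_eval (fun i => (κ i).prod (ν.prod ν)) i)

/-- The message `v i` as a function of the noise of the clients. -/
def vmsg (G : Fin N → Vec d → Z → Vec d) (C : Vec d → Ξ → Vec d) (s : State d N) (i : Fin N)
    (θ : Fin N → ClientNoise b Z Ξ) : Vec d :=
  message (G i) C s.x (s.hloc i) (noiseV i θ)

/-- The message `u i` as a function of the noise of the clients. -/
def umsg (G : Fin N → Vec d → Z → Vec d) (C : Vec d → Ξ → Vec d) (s : State d N) (i : Fin N)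
    (θ : Fin N → ClientNoise b Z Ξ) : Vec d :=
  message (G i) C s.x (s.hloc i) (noiseU i θ)

/-- The gradient estimate as a function of the second sampled set and the noise of the clients. -/
def gradEst (G : Fin N → Vec d → Z → Vec d) (C : Vec d → Ξ → Vec d) (S : ℕ) (s : State d N)
    (p : Finset (Fin N) × (Fin N → ClientNoise b Z Ξ)) : Vec d :=
  (1 / (S : ℝ)) • sampledSum (vmsg G C s) p + s.h

lemma estimate_eq (s : State d N) (r : RoundNoise N b Z Ξ) :
    estimate G C S s r = gradEst G C S s (r.1.2, r.2) := rfl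

lemma memLp_vmsg (hG : IsStochasticGradient f D G σ) (hC : IsCompressor ν C ω)
    (hκ : ∀ i, IsMinibatchPairLaw (D i) (κ i)) (s : State d N) (i : Fin N) :
    MemLp (vmsg G C s i) 2 (noiseLaw κ ν) :=
  (memLp_message hG hC i s.x (s.hloc i)).comp_measurePreserving (measurePreserving_noiseV hκ i)

lemma memLp_umsg (hG : IsStochasticGradient f D G σ) (hC : IsCompressor ν C ω)
    (hκ : ∀ i, IsMinibatchPairLaw (D i) (κ i)) (s : State d N) (i : Fin N) :
    MemLp (umsg G C s i) 2 (noiseLaw κ ν) :=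
  (memLp_message hG hC i s.x (s.hloc i)).comp_measurePreserving (measurePreserving_noiseU hκ i)

lemma integral_comp_measurePreserving {α β E : Type*} [MeasurableSpace α] [MeasurableSpace β]
    [NormedAddCommGroup E] [NormedSpace ℝ E] {μ : Measure α} {μ' : Measure β} {T : α → β}
    (hT : MeasurePreserving T μ μ') {g : β → E} (hg : AEStronglyMeasurable g μ') :
    ∫ a, g (T a) ∂μ = ∫ y, g y ∂μ' := by
  rw [← hT.map_eq] at hg ⊢
  exact (integral_map hT.measurable.aemeasurable hg).symm

lemma integral_vmsg (hb : 1 ≤ b) (hG : IsStochasticGradient f D G σ) (hC : IsCompressor ν C ω)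
    (hκ : ∀ i, IsMinibatchPairLaw (D i) (κ i)) (s : State d N) (i : Fin N) :
    ∫ θ, vmsg G C s i θ ∂(noiseLaw κ ν) = gradient (f i) s.x - s.hloc i :=
  (integral_comp_measurePreserving (measurePreserving_noiseV hκ i)
    (memLp_message hG hC i s.x (s.hloc i)).1).trans (integral_message hb hG hC i _ _)

lemma integral_umsg (hb : 1 ≤ b) (hG : IsStochasticGradient f D G σ) (hC : IsCompressor ν C ω)
    (hκ : ∀ i, IsMinibatchPairLaw (D i) (κ i)) (s : State d N) (i : Fin N) :
    ∫ θ, umsg G C s i θ ∂(noiseLaw κ ν) = gradient (f i) s.x - s.hloc i :=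
  (integral_comp_measurePreserving (measurePreserving_noiseU hκ i)
    (memLp_message hG hC i s.x (s.hloc i)).1).trans (integral_message hb hG hC i _ _)

lemma integral_norm_sq_vmsg_le (hb : 1 ≤ b) (hω : 0 ≤ ω) (hG : IsStochasticGradient f D G σ)
    (hC : IsCompressor ν C ω) (hκ : ∀ i, IsMinibatchPairLaw (D i) (κ i)) (s : State d N)
    (i : Fin N) :
    ∫ θ, ‖vmsg G C s i θ‖ ^ 2 ∂(noiseLaw κ ν) ≤
      (1 + ω) * (‖gradient (f i) s.x - s.hloc i‖ ^ 2 + σ ^ 2 / b) :=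
  (integral_comp_measurePreserving (measurePreserving_noiseV hκ i)
    (g := fun p => ‖message (G i) C s.x (s.hloc i) p‖ ^ 2)
    ((memLp_message hG hC i s.x (s.hloc i)).1.norm.pow 2)).trans_le
    (integral_norm_sq_message_le hb hω hG hC i _ _)

lemma integral_norm_sq_umsg_le (hb : 1 ≤ b) (hω : 0 ≤ ω) (hG : IsStochasticGradient f D G σ)
    (hC : IsCompressor ν C ω) (hκ : ∀ i, IsMinibatchPairLaw (D i) (κ i)) (s : State d N)
    (i : Fin N) :
    ∫ θ, ‖umsg G C s i θ‖ ^ 2 ∂(noiseLaw κ ν) ≤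
      (1 + ω) * (‖gradient (f i) s.x - s.hloc i‖ ^ 2 + σ ^ 2 / b) :=
  (integral_comp_measurePreserving (measurePreserving_noiseU hκ i)
    (g := fun p => ‖message (G i) C s.x (s.hloc i) p‖ ^ 2)
    ((memLp_message hG hC i s.x (s.hloc i)).1.norm.pow 2)).trans_le
    (integral_norm_sq_message_le hb hω hG hC i _ _)

/-- Only independence between different clients enters; the dependence of the two minibatches of one
client plays no role. -/
lemma integral_inner_vmsg (hG : IsStochasticGradient f D G σ) (hC : IsCompressor ν C ω)
    (hκ : ∀ i, IsMinibatchPairLaw (D i) (κ i)) (s : State d N) {i j : Fin N} (hij : i ≠ j) :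
    ∫ θ, ⟪vmsg G C s i θ, vmsg G C s j θ⟫ ∂(noiseLaw κ ν) =
      ⟪∫ θ, vmsg G C s i θ ∂(noiseLaw κ ν), ∫ θ, vmsg G C s j θ ∂(noiseLaw κ ν)⟫ := by
  have := fun i => (hκ i).isProbabilityMeasure
  have := isProbabilityMeasure_noiseLaw (ν := ν) hκ
  have hind : iIndepFun (fun (i : Fin N) (θ : Fin N → ClientNoise b Z Ξ) => vmsg G C s i θ)
      (noiseLaw κ ν) :=
    iIndepFun_pi (X := fun i (c : ClientNoise b Z Ξ) =>
      message (G i) C s.x (s.hloc i) (c.1.2, c.2.2)) fun i =>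
      ((measurable_message hG hC i s.x (s.hloc i)).comp
        (measurePreserving_noise_snd (ν := ν) (hκ i)).measurable).aemeasurable
  exact integral_inner_of_indepFun (hind.indepFun hij)
    ((memLp_vmsg hG hC hκ s i).integrable one_le_two)
    ((memLp_vmsg hG hC hκ s j).integrable one_le_two)

lemma memLp_gradEst (hSN : S ≤ N) (hG : IsStochasticGradient f D G σ) (hC : IsCompressor ν C ω)
    (hκ : ∀ i, IsMinibatchPairLaw (D i) (κ i)) (s : State d N) :
    MemLp (gradEst G C S s) 2 ((clientLaw N S).prod (noiseLaw κ ν)) := by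
  have := isProbabilityMeasure_noiseLaw (ν := ν) hκ
  have := isProbabilityMeasure_clientLaw hSN
  exact ((memLp_sampledSum hSN (memLp_vmsg hG hC hκ s)).const_smul (1 / (S : ℝ))).add
    (memLp_const s.h)

/-- This is the unbiasedness of the estimate: the shifts subtracted by the clients are restored on
average by the shift of the server. -/
lemma mean_residual_add {L : ℝ} (hf : IsSmooth f L) {s : State d N}
    (hs : s.h = (1 / (N : ℝ)) • ∑ i, s.hloc i) :
    (1 / (N : ℝ)) • ∑ i, (gradient (f i) s.x - s.hloc i) + s.h = gradient (objective f) s.x := by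
  rw [hf.gradient_objective, hs, Finset.sum_sub_distrib, smul_sub, sub_add_cancel]

lemma integral_gradEst (hb : 1 ≤ b) (hS : 1 ≤ S) (hSN : S ≤ N) {L : ℝ} (hf : IsSmooth f L)
    (hG : IsStochasticGradient f D G σ) (hC : IsCompressor ν C ω)
    (hκ : ∀ i, IsMinibatchPairLaw (D i) (κ i)) {s : State d N}
    (hs : s.h = (1 / (N : ℝ)) • ∑ i, s.hloc i) :
    ∫ p, gradEst G C S s p ∂((clientLaw N S).prod (noiseLaw κ ν)) =
      gradient (objective f) s.x := by
  have := isProbabilityMeasure_noiseLaw (ν := ν) hκ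
  unfold gradEst
  rw [integral_sampled_average hS hSN (memLp_vmsg hG hC hκ s)]
  simp_rw [integral_vmsg hb hG hC hκ s]
  exact mean_residual_add hf hs

lemma mean_le_gradError (hS : 1 ≤ S) (hSN : S ≤ N) {m : Fin N → ℝ} {q n : ℝ} {s : State d N}
    (hm : ∀ i, m i ≤ q * (‖gradient (f i) s.x - s.hloc i‖ ^ 2 + n)) :
    1 / ((S : ℝ) * N) * ∑ i, m i ≤ q / S * (gradError f s + n) := by
  have hS0 : (0 : ℝ) < S := by exact_mod_cast hS
  have hN0 : (0 : ℝ) < N := by exact_mod_cast hS.trans hSN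
  have h := mul_le_mul_of_nonneg_left (Finset.sum_le_sum fun i (_ : i ∈ Finset.univ) => hm i)
    (by positivity : 0 ≤ 1 / ((S : ℝ) * N))
  refine h.trans_eq ?_
  rw [← Finset.mul_sum, Finset.sum_add_distrib, Finset.sum_const, Finset.card_univ,
    Fintype.card_fin, nsmul_eq_mul]
  unfold gradError meanSq
  field_simp

lemma integral_norm_sq_gradEst_le (hb : 1 ≤ b) (hω : 0 ≤ ω) (hS : 1 ≤ S) (hSN : S ≤ N) {L : ℝ}
    (hf : IsSmooth f L) (hG : IsStochasticGradient f D G σ) (hC : IsCompressor ν C ω)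
    (hκ : ∀ i, IsMinibatchPairLaw (D i) (κ i)) {s : State d N}
    (hs : s.h = (1 / (N : ℝ)) • ∑ i, s.hloc i) :
    ∫ p, ‖gradEst G C S s p‖ ^ 2 ∂((clientLaw N S).prod (noiseLaw κ ν)) ≤
      ‖gradient (objective f) s.x‖ ^ 2 + (1 + ω) / S * (gradError f s + σ ^ 2 / b) := by
  have := isProbabilityMeasure_noiseLaw (ν := ν) hκ
  unfold gradEst
  refine (integral_norm_sq_sampled_average_le hS hSN (memLp_vmsg hG hC hκ s)
    (fun i j hij => integral_inner_vmsg hG hC hκ s hij) s.h).trans ?_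
  simp_rw [integral_vmsg hb hG hC hκ s]
  rw [mean_residual_add hf hs]
  exact add_le_add le_rfl
    (mean_le_gradError hS hSN fun i => integral_norm_sq_vmsg_le hb hω hG hC hκ s i)

end Round

/-! ### One-round recursions for the virtual points and the local shifts. -/

section RoundErrors

variable {d N S b : ℕ} {Z Ξ : Type*} [MeasurableSpace Z] [MeasurableSpace Ξ]
  {f : Fin N → Vec d → ℝ} {D : Fin N → Measure Z} [∀ i, IsProbabilityMeasure (D i)]
  {G : Fin N → Vec d → Z → Vec d} {σ : ℝ}
  {ν : Measure Ξ} [IsProbabilityMeasure ν] {C : Vec d → Ξ → Vec d} {ω : ℝ}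
  {κ : Fin N → Measure ((Fin b → Z) × (Fin b → Z))}

lemma integrable_meanSq {Θ : Type*} [MeasurableSpace Θ] {ρ : Measure Θ}
    {X : Θ → Fin N → Vec d} (hX : ∀ i, Integrable (fun r => ‖X r i‖ ^ 2) ρ) :
    Integrable (fun r => meanSq (X r)) ρ :=
  (integrable_finsetSum _ fun i _ => hX i).const_mul _

lemma integral_meanSq_le {Θ : Type*} [MeasurableSpace Θ] {ρ : Measure Θ}
    {X : Θ → Fin N → Vec d} (hX : ∀ i, Integrable (fun r => ‖X r i‖ ^ 2) ρ) {B : Fin N → ℝ}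
    (hB : ∀ i, ∫ r, ‖X r i‖ ^ 2 ∂ρ ≤ B i) :
    ∫ r, meanSq (X r) ∂ρ ≤ (1 / (N : ℝ)) * ∑ i, B i := by
  unfold meanSq
  rw [integral_const_mul, integral_finsetSum _ fun i _ => hX i]
  gcongr with i
  exact hB i

lemma roundLaw_eq : roundLaw S κ ν =
    ((clientLaw N S).prod (clientLaw N S)).prod (noiseLaw κ ν) := rfl

lemma mean_affine (hN : 1 ≤ N) (c₁ c₂ c₃ : ℝ) (v w : Fin N → Vec d) :
    (1 / (N : ℝ)) * ∑ i, (c₁ * ‖v i‖ ^ 2 + c₂ * ‖w i‖ ^ 2 + c₃) =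
      c₁ * meanSq v + c₂ * meanSq w + c₃ := by
  have hN0 : (N : ℝ) ≠ 0 := by positivity
  unfold meanSq
  rw [Finset.sum_add_distrib, Finset.sum_add_distrib, ← Finset.mul_sum, ← Finset.mul_sum,
    Finset.sum_const, Finset.card_univ, Fintype.card_fin, nsmul_eq_mul]
  field_simp

/-- The expected error of the virtual points after one round. -/
lemma pointError_step (hb : 1 ≤ b) (hω : 0 ≤ ω) (hS : 1 ≤ S) (hSN : S ≤ N) {L : ℝ}
    (hf : IsSmooth f L) (hG : IsStochasticGradient f D G σ) (hC : IsCompressor ν C ω)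
    (hκ : ∀ i, IsMinibatchPairLaw (D i) (κ i)) {s : State d N}
    (hs : s.h = (1 / (N : ℝ)) • ∑ i, s.hloc i) (η α : ℝ) :
    Integrable (fun r => pointError (step G C S η α s r)) (roundLaw S κ ν) ∧
    ∫ r, pointError (step G C S η α s r) ∂(roundLaw S κ ν) ≤
      (1 - (S : ℝ) / N / 2) * pointError s +
        η ^ 2 * (2 / ((S : ℝ) / N) * ‖gradient (objective f) s.x‖ ^ 2 +
          (1 + ω) / S * (gradError f s + σ ^ 2 / b)) := by
  have := isProbabilityMeasure_noiseLaw (ν := ν) hκ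
  have := isProbabilityMeasure_clientLaw hSN
  have hS0 : (0 : ℝ) < S := by exact_mod_cast hS
  have hN0 : (0 : ℝ) < N := by exact_mod_cast hS.trans hSN
  have hp0 : 0 < (S : ℝ) / N := by positivity
  have hp1 : (S : ℝ) / N ≤ 1 := (div_le_one hN0).2 (by exact_mod_cast hSN)
  rw [roundLaw_eq]
  set P := (clientLaw N S).prod (noiseLaw κ ν) with hP
  have hg : MemLp (fun p => -η • gradEst G C S s p) 2 P :=
    (memLp_gradEst hSN hG hC hκ s).const_smul (-η)
  have hmean : ∫ p, -η • gradEst G C S s p ∂P = -η • gradient (objective f) s.x := by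
    rw [integral_smul, integral_gradEst hb hS hSN hf hG hC hκ hs]
  have hsq : ∫ p, ‖-η • gradEst G C S s p‖ ^ 2 ∂P = η ^ 2 * ∫ p, ‖gradEst G C S s p‖ ^ 2 ∂P := by
    simp_rw [norm_smul, mul_pow, norm_neg, Real.norm_eq_abs, sq_abs]
    rw [integral_const_mul]
  have hI2 := integral_norm_sq_gradEst_le hb hω hS hSN hf hG hC hκ hs
  rw [← hP] at hI2
  set I₂ := ∫ p, ‖gradEst G C S s p‖ ^ 2 ∂P
  set g := gradient (objective f) s.x
  set p := (S : ℝ) / N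
  set V := (1 + ω) / S * (gradError f s + σ ^ 2 / b)
  have hψ : ∀ i, Integrable (fun p => ‖-η • gradEst G C S s p + (s.x - s.w i)‖ ^ 2) P := fun i =>
    (hg.add (memLp_const (s.x - s.w i))).integrable_norm_pow two_ne_zero
  have hmix := fun i => integral_sel_mix hS hSN i (hg.integrable_norm_pow two_ne_zero) (hψ i)
  have hpt : ∀ (r : RoundNoise N b Z Ξ) i,
      ‖(step G C S η α s r).x - (step G C S η α s r).w i‖ ^ 2 =
      if i ∈ r.1.1 then ‖-η • gradEst G C S s (r.1.2, r.2)‖ ^ 2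
      else ‖-η • gradEst G C S s (r.1.2, r.2) + (s.x - s.w i)‖ ^ 2 := by
    intro r i
    simp only [step, estimate_eq]
    split_ifs
    · congr 2; rw [neg_smul]; abel
    · congr 2; rw [neg_smul]; abel
  have hint : ∀ i, Integrable (fun r : RoundNoise N b Z Ξ =>
      ‖(step G C S η α s r).x - (step G C S η α s r).w i‖ ^ 2)
      (((clientLaw N S).prod (clientLaw N S)).prod (noiseLaw κ ν)) := fun i => by
    simp_rw [hpt]; exact (hmix i).1
  -- The vanishing middle term only brings the bound into the form required by `mean_affine`.
  have hval : ∀ i, ∫ r : RoundNoise N b Z Ξ,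
      ‖(step G C S η α s r).x - (step G C S η α s r).w i‖ ^ 2
      ∂(((clientLaw N S).prod (clientLaw N S)).prod (noiseLaw κ ν)) ≤
      (1 - p / 2) * ‖s.x - s.w i‖ ^ 2 + 0 * ‖s.x - s.w i‖ ^ 2 +
        η ^ 2 * (2 / p * ‖g‖ ^ 2 + V) := fun i => by
    simp_rw [hpt]
    rw [(hmix i).2, integral_norm_add_const_sq hg, hmean, hsq]
    -- Young's inequality balanced so that the cross term costs half of the contraction: (1 - p)(1 +
    -- p/2) ≤ 1 - p/2.
    have hcs : 2 * ⟪-η • g, s.x - s.w i⟫ ≤ p / 2 * ‖s.x - s.w i‖ ^ 2 + 2 / p * (η ^ 2 * ‖g‖ ^ 2) := by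
      have h1 := real_inner_le_norm (-η • g) (s.x - s.w i)
      have h2 : p / 2 * ‖s.x - s.w i‖ ^ 2 + 2 / p * (η ^ 2 * ‖g‖ ^ 2) -
          2 * (‖-η • g‖ * ‖s.x - s.w i‖) =
          (p * ‖s.x - s.w i‖ - 2 * ‖-η • g‖) ^ 2 / (2 * p) := by
        have h3 : η ^ 2 * ‖g‖ ^ 2 = ‖-η • g‖ ^ 2 := by
          rw [norm_smul, mul_pow, norm_neg, Real.norm_eq_abs, sq_abs]
        rw [h3]
        field_simp
        ring
      have h4 : 0 ≤ (p * ‖s.x - s.w i‖ - 2 * ‖-η • g‖) ^ 2 / (2 * p) := by positivity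
      linarith
    have h1p : 0 ≤ 1 - p := by linarith
    have hA := mul_le_mul_of_nonneg_left hcs h1p
    have hB := mul_le_mul_of_nonneg_left hI2 (sq_nonneg η)
    have hw : 0 ≤ p ^ 2 * ‖s.x - s.w i‖ ^ 2 := by positivity
    -- The factor 1 - p leaves a surplus of -2η²‖g‖², which absorbs the squared mean contained in
    -- the second moment of the estimate.
    have e : (1 - p) * (2 / p * (η ^ 2 * ‖g‖ ^ 2)) =
        2 / p * (η ^ 2 * ‖g‖ ^ 2) - 2 * (η ^ 2 * ‖g‖ ^ 2) := by
      field_simp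
    have hg0 : 0 ≤ η ^ 2 * ‖g‖ ^ 2 := by positivity
    nlinarith
  refine ⟨integrable_meanSq hint, (integral_meanSq_le hint hval).trans_eq ?_⟩
  rw [mean_affine (hS.trans hSN)]
  unfold pointError
  ring

/-- The expected error of the local shifts after one round. -/
lemma shiftError_step (hb : 1 ≤ b) (hω : 0 ≤ ω) (hS : 1 ≤ S) (hSN : S ≤ N)
    (hG : IsStochasticGradient f D G σ) (hC : IsCompressor ν C ω)
    (hκ : ∀ i, IsMinibatchPairLaw (D i) (κ i)) (s : State d N) (η : ℝ) :
    Integrable (fun r => shiftError f (step G C S η (1 / (1 + ω)) s r)) (roundLaw S κ ν) ∧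
    ∫ r, shiftError f (step G C S η (1 / (1 + ω)) s r) ∂(roundLaw S κ ν) ≤
      (1 - (S : ℝ) / N) * shiftError f s +
        (S : ℝ) / N * ((1 - 1 / (1 + ω)) * gradError f s + 1 / (1 + ω) * (σ ^ 2 / b)) := by
  have := isProbabilityMeasure_noiseLaw (ν := ν) hκ
  have := isProbabilityMeasure_clientLaw hSN
  have hq : 0 < 1 + ω := by linarith
  rw [roundLaw_eq]
  set P := (clientLaw N S).prod (noiseLaw κ ν) with hP
  set α := 1 / (1 + ω) with hα
  set p := (S : ℝ) / N
  have hp0 : 0 ≤ p := by positivity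
  have hu : ∀ i, MemLp (fun θ => -α • umsg G C s i θ) 2 (noiseLaw κ ν) := fun i =>
    (memLp_umsg hG hC hκ s i).const_smul (-α)
  have hu2 : ∀ i, MemLp (fun θ => -α • umsg G C s i θ + (gradient (f i) s.x - s.hloc i)) 2
      (noiseLaw κ ν) := fun i => (hu i).add (memLp_const _)
  have hsnd : MeasurePreserving Prod.snd P (noiseLaw κ ν) := measurePreserving_snd
  have hφ : ∀ i, Integrable (fun p : Finset (Fin N) × (Fin N → ClientNoise b Z Ξ) =>
      ‖-α • umsg G C s i p.2 + (gradient (f i) s.x - s.hloc i)‖ ^ 2) P := fun i =>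
    hsnd.integrable_comp_of_integrable ((hu2 i).integrable_norm_pow two_ne_zero)
  have hψ : ∀ i, Integrable (fun _ : Finset (Fin N) × (Fin N → ClientNoise b Z Ξ) =>
      ‖gradient (f i) (s.w i) - s.hloc i‖ ^ 2) P := fun i => integrable_const _
  have hmix := fun i => integral_sel_mix hS hSN i (hφ i) (hψ i)
  have hpt : ∀ (r : RoundNoise N b Z Ξ) i,
      ‖gradient (f i) ((step G C S η α s r).w i) - (step G C S η α s r).hloc i‖ ^ 2 =
      if i ∈ r.1.1 then ‖-α • umsg G C s i r.2 + (gradient (f i) s.x - s.hloc i)‖ ^ 2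
      else ‖gradient (f i) (s.w i) - s.hloc i‖ ^ 2 := by
    intro r i
    have hmsg : messageU G C s r i = umsg G C s i r.2 := rfl
    simp only [step, hmsg]
    split_ifs
    · congr 2; rw [neg_smul]; abel
    · rfl
  have hint : ∀ i, Integrable (fun r : RoundNoise N b Z Ξ =>
      ‖gradient (f i) ((step G C S η α s r).w i) - (step G C S η α s r).hloc i‖ ^ 2)
      (((clientLaw N S).prod (clientLaw N S)).prod (noiseLaw κ ν)) := fun i => by
    simp_rw [hpt]; exact (hmix i).1
  have hval : ∀ i, ∫ r : RoundNoise N b Z Ξ,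
      ‖gradient (f i) ((step G C S η α s r).w i) - (step G C S η α s r).hloc i‖ ^ 2
      ∂(((clientLaw N S).prod (clientLaw N S)).prod (noiseLaw κ ν)) ≤
      (1 - p) * ‖gradient (f i) (s.w i) - s.hloc i‖ ^ 2 +
        p * (1 - α) * ‖gradient (f i) s.x - s.hloc i‖ ^ 2 + p * (α * (σ ^ 2 / b)) := fun i => by
    simp_rw [hpt]
    rw [(hmix i).2]
    have h1 : ∫ p : Finset (Fin N) × (Fin N → ClientNoise b Z Ξ),
        ‖-α • umsg G C s i p.2 + (gradient (f i) s.x - s.hloc i)‖ ^ 2 ∂P ≤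
        (1 - α) * ‖gradient (f i) s.x - s.hloc i‖ ^ 2 + α * (σ ^ 2 / b) := by
      rw [integral_comp_measurePreserving hsnd
        (g := fun θ => ‖-α • umsg G C s i θ + (gradient (f i) s.x - s.hloc i)‖ ^ 2)
        ((hu2 i).1.norm.pow 2), integral_norm_add_const_sq (hu i), integral_smul,
        integral_umsg hb hG hC hκ s i]
      simp_rw [norm_smul, mul_pow]
      rw [integral_const_mul, norm_neg, Real.norm_eq_abs, sq_abs, real_inner_smul_left,
        real_inner_self_eq_norm_sq]
      have h2 := mul_le_mul_of_nonneg_left (integral_norm_sq_umsg_le hb hω hG hC hκ s i)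
        (sq_nonneg α)
      -- Here α = 1 / (1 + ω) is used: α²(1 + ω) = α, so the quadratic term costs only half of the
      -- gain 2α from the cross term.
      have h3 : α ^ 2 * ((1 + ω) * (‖gradient (f i) s.x - s.hloc i‖ ^ 2 + σ ^ 2 / b)) =
          α * (‖gradient (f i) s.x - s.hloc i‖ ^ 2 + σ ^ 2 / b) := by
        rw [hα]; field_simp
      rw [h3] at h2
      linarith
    have h4 := mul_le_mul_of_nonneg_left h1 hp0
    rw [integral_const]
    simp only [probReal_univ, one_smul]
    linarith
  refine ⟨integrable_meanSq hint, (integral_meanSq_le hint hval).trans_eq ?_⟩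
  rw [mean_affine (hS.trans hSN)]
  unfold shiftError gradError
  ring

end RoundErrors

/-! ### The Lyapunov function -/

/-- The coefficient of `pointError` in the Lyapunov function. -/
def pointWeight (N S : ℕ) (L ω η : ℝ) : ℝ :=
  6 * ((1 + ω) ^ 3 * N * L ^ 2 * η ^ 2 / (S : ℝ) ^ 2) * L

/-- The total weight of the variance of the gradient estimate. -/
def varianceWeight (N S : ℕ) (L ω η : ℝ) : ℝ :=
  η ^ 2 * (L / 2 + pointWeight N S L ω η)

/-- The coefficient of `shiftError` in the Lyapunov function. -/
def shiftWeight (N S : ℕ) (L ω η : ℝ) : ℝ :=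
  2 * (1 + ω) ^ 2 * N / (S : ℝ) ^ 2 * varianceWeight N S L ω η

/-- The conditions on the step size that make the Lyapunov function decrease. -/
structure IsSmallStep (N S : ℕ) (L ω η : ℝ) : Prop where
  pos : 0 < η
  le_inv_smooth : L * η ≤ 1 / 2
  le_sqrt : (1 + ω) ^ 3 * N * L ^ 2 * η ^ 2 / (S : ℝ) ^ 2 ≤ 1 / 25
  le_rpow : (1 + ω) ^ 3 * N * L ^ 2 * η ^ 2 / (S : ℝ) ^ 2 * (L * η) * ((N : ℝ) / S) ≤ 1 / 125

/-! ### Bounds for the weights and the deterministic descent inequality. -/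

section Weights

variable {N S : ℕ} {L ω η : ℝ}

lemma pointWeight_nonneg (hL : 0 < L) (hω : 0 ≤ ω) : 0 ≤ pointWeight N S L ω η := by
  unfold pointWeight; positivity

lemma varianceWeight_nonneg (hL : 0 < L) (hω : 0 ≤ ω) : 0 ≤ varianceWeight N S L ω η := by
  have := pointWeight_nonneg (N := N) (S := S) (η := η) hL hω
  unfold varianceWeight; positivity

lemma shiftWeight_nonneg (hL : 0 < L) (hω : 0 ≤ ω) : 0 ≤ shiftWeight N S L ω η := by
  have := varianceWeight_nonneg (N := N) (S := S) (η := η) hL hω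
  unfold shiftWeight; positivity

/-- The constant is 1/2 + 6/25, where 6 comes from `pointWeight` and 1/25 from `le_sqrt`. -/
lemma varianceWeight_le (hL : 0 < L) (hη : IsSmallStep N S L ω η) :
    varianceWeight N S L ω η ≤ 37 / 50 * (L * η ^ 2) := by
  unfold varianceWeight pointWeight
  have h := mul_le_mul_of_nonneg_right hη.le_sqrt (by positivity : 0 ≤ L * η ^ 2)
  nlinarith

/-- This is what lets the initial shifts enter the initial error with the factor 1 / L. -/
lemma shiftWeight_le (hL : 0 < L) (hω : 0 ≤ ω) (hη : IsSmallStep N S L ω η) :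
    shiftWeight N S L ω η ≤ 1 / L := by
  have h1 := varianceWeight_le hL hη
  have hQ := hη.le_sqrt
  have h2 : shiftWeight N S L ω η ≤
      2 * (1 + ω) ^ 2 * N / (S : ℝ) ^ 2 * (37 / 50 * (L * η ^ 2)) := by
    unfold shiftWeight; gcongr
  have h3 : 2 * (1 + ω) ^ 2 * N / (S : ℝ) ^ 2 * (37 / 50 * (L * η ^ 2)) =
      37 / 25 * ((1 + ω) ^ 3 * N * L ^ 2 * η ^ 2 / (S : ℝ) ^ 2) * (1 / (1 + ω)) * (1 / L) := by
    field_simp; ring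
  have h4 : 1 / (1 + ω) ≤ 1 := by rw [div_le_one (by positivity)]; linarith
  rw [h3] at h2
  refine h2.trans (mul_le_of_le_one_left (by positivity) ?_)
  have h5 : 0 ≤ 1 / (1 + ω) := by positivity
  have h6 : 0 ≤ (1 + ω) ^ 3 * N * L ^ 2 * η ^ 2 / (S : ℝ) ^ 2 := by positivity
  nlinarith

/-- One round decreases the Lyapunov function, up to the stochastic noise. -/
lemma lyapunov_inequality (hS : 1 ≤ S) (hSN : S ≤ N) (hL : 0 < L) (hω : 0 ≤ ω)
    (hη : IsSmallStep N S L ω η) {A W H n g W' H' F F' : ℝ} (hW : 0 ≤ W) (hg : 0 ≤ g)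
    (hA : A ≤ 2 * (1 + ω) * (L ^ 2 * W) + 2 * (1 + ω) / (2 * (1 + ω) - 1) * H)
    (hW' : W' ≤ (1 - (S : ℝ) / N / 2) * W +
      η ^ 2 * (2 / ((S : ℝ) / N) * g + (1 + ω) / S * (A + n)))
    (hH' : H' ≤ (1 - (S : ℝ) / N) * H +
      (S : ℝ) / N * ((1 - 1 / (1 + ω)) * A + 1 / (1 + ω) * n))
    (hF' : F' ≤ F - η * g + L / 2 * η ^ 2 * (g + (1 + ω) / S * (A + n))) :
    F' + pointWeight N S L ω η * W' + shiftWeight N S L ω η * H' ≤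
      F + pointWeight N S L ω η * W + shiftWeight N S L ω η * H - 13 / 20 * η * g +
        3 * varianceWeight N S L ω η * ((1 + ω) / S) * n := by
  have hS0 : (0 : ℝ) < S := by exact_mod_cast hS
  have hN0 : (0 : ℝ) < N := by exact_mod_cast hS.trans hSN
  have hc := pointWeight_nonneg (N := N) (S := S) (η := η) hL hω
  have hM := varianceWeight_nonneg (N := N) (S := S) (η := η) hL hω
  have hcH := shiftWeight_nonneg (N := N) (S := S) (η := η) hL hω
  have hMle := varianceWeight_le hL hη
  have hq : 1 ≤ 1 + ω := by linarith
  have e1 : shiftWeight N S L ω η * ((S : ℝ) / N) =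
      2 * (1 + ω) ^ 2 / S * varianceWeight N S L ω η := by
    unfold shiftWeight; field_simp
  have e2 : pointWeight N S L ω η * ((S : ℝ) / N) = 6 * (1 + ω) ^ 3 * L ^ 3 * η ^ 2 / S := by
    unfold pointWeight; field_simp
  -- The movement of the model enters W with the large factor 2 / p; bounding this term is the
  -- purpose of `le_rpow`, hence of the term with N^(2/3) in the step size.
  have e3 : pointWeight N S L ω η * (η ^ 2 * (2 / ((S : ℝ) / N))) ≤ 12 / 125 * η := by
    have h := mul_le_mul_of_nonneg_right hη.le_rpow hη.pos.le
    unfold pointWeight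
    have e : 6 * ((1 + ω) ^ 3 * N * L ^ 2 * η ^ 2 / (S : ℝ) ^ 2) * L *
        (η ^ 2 * (2 / ((S : ℝ) / N))) = 12 * ((1 + ω) ^ 3 * N * L ^ 2 * η ^ 2 / (S : ℝ) ^ 2 *
        (L * η) * ((N : ℝ) / S) * η) := by field_simp; ring
    rw [e]
    linarith
  have e4 : L / 2 * η ^ 2 + pointWeight N S L ω η * η ^ 2 = varianceWeight N S L ω η := by
    unfold varianceWeight; ring
  set c := pointWeight N S L ω η
  set M := varianceWeight N S L ω η
  set cH := shiftWeight N S L ω η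
  set q := 1 + ω
  set p := (S : ℝ) / N
  have hq0 : 0 < q := by linarith
  have h2q : 0 < 2 * q - 1 := by linarith
  have hMq : 0 ≤ M * q / S := by positivity
  -- the total weight of the residual `A`
  have hAw : M * (q / S) + cH * p * (1 - 1 / q) = M * q / S * (2 * q - 1) := by
    rw [e1]; field_simp; ring
  -- The noise enters once through the estimate with weight M q / S and twice that through the
  -- shifts, whence the factor 3.
  have hnw : M * (q / S) + cH * p * (1 / q) = 3 * M * (q / S) := by
    rw [e1]; field_simp; ring
  -- Splitting A gives H the coefficient (M q / S) · 2q, which equals c_H p: exactly the contraction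
  -- of H. This identity dictates the value of `shiftWeight`.
  have hA2 : M * q / S * (2 * q - 1) * A ≤
      M * q / S * (2 * q - 1) * (2 * q * (L ^ 2 * W)) + cH * p * H := by
    have h := mul_le_mul_of_nonneg_left hA (by positivity : 0 ≤ M * q / S * (2 * q - 1))
    have e : (2 * q - 1) * (2 * q / (2 * q - 1)) = 2 * q := mul_div_cancel₀ _ h2q.ne'
    refine h.trans_eq ?_
    rw [e1]
    linear_combination M * q / S * H * e
  -- The part of A carried by W must fit into the contraction c p / 2. It needs (37/25)(2q - 1) ≤
  -- 3q, and the 3 is half of the 6 in `pointWeight`.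
  have hWw : M * q / S * (2 * q - 1) * (2 * q * L ^ 2) ≤ c * p / 2 := by
    rw [e2]
    have h1 : M * q / S * (2 * q - 1) * (2 * q * L ^ 2) ≤
        37 / 50 * (L * η ^ 2) * q / S * (2 * q - 1) * (2 * q * L ^ 2) := by gcongr
    have h2 : 37 / 50 * (L * η ^ 2) * q / S * (2 * q - 1) * (2 * q * L ^ 2) =
        37 / 25 * (q ^ 2 * L ^ 3 * η ^ 2 / S) * (2 * q - 1) := by ring
    have h3 : 6 * q ^ 3 * L ^ 3 * η ^ 2 / S / 2 = 3 * (q ^ 2 * L ^ 3 * η ^ 2 / S) * q := by ring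
    have h4 : 0 ≤ q ^ 2 * L ^ 3 * η ^ 2 / S := by positivity
    rw [h2] at h1
    rw [h3]
    nlinarith
  have hWw2 := mul_le_mul_of_nonneg_right hWw hW
  -- The losses are at most η/4 from Lη ≤ 1/2 and 12η/125 from `e3`, together below 7η/20.
  have hgw : (L / 2 * η ^ 2 + c * (η ^ 2 * (2 / p))) * g ≤ 7 / 20 * η * g := by
    refine mul_le_mul_of_nonneg_right ?_ hg
    have := mul_le_mul_of_nonneg_right hη.le_inv_smooth hη.pos.le
    nlinarith [hη.pos]
  have t1 := mul_le_mul_of_nonneg_left hW' hc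
  have t2 := mul_le_mul_of_nonneg_left hH' hcH
  linear_combination t1 + t2 + hF' + hA2 + hWw2 + hgw + A * hAw + n * hnw +
    q / S * (A + n) * e4

end Weights

/-! ### Expected decrease of the Lyapunov function in one round. -/

section Lyapunov

variable {d N S b : ℕ} {Z Ξ : Type*} [MeasurableSpace Z] [MeasurableSpace Ξ]
  {f : Fin N → Vec d → ℝ} {D : Fin N → Measure Z} [∀ i, IsProbabilityMeasure (D i)]
  {G : Fin N → Vec d → Z → Vec d} {σ : ℝ}
  {ν : Measure Ξ} [IsProbabilityMeasure ν] {C : Vec d → Ξ → Vec d} {L ω η : ℝ}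
  {κ : Fin N → Measure ((Fin b → Z) × (Fin b → Z))}

/-- The Lyapunov function. -/
def lyapunov (f : Fin N → Vec d → ℝ) (S : ℕ) (L ω η : ℝ) (s : State d N) : ℝ :=
  (objective f s.x - ⨅ x, objective f x) + pointWeight N S L ω η * pointError s +
    shiftWeight N S L ω η * shiftError f s

lemma lyapunov_nonneg (hL : 0 < L) (hω : 0 ≤ ω) (hbdd : BddBelow (Set.range (objective f)))
    (s : State d N) : 0 ≤ lyapunov f S L ω η s := by
  have h1 := ciInf_le hbdd s.x
  have h2 := mul_nonneg (pointWeight_nonneg (N := N) (S := S) (η := η) hL hω)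
    (meanSq_nonneg fun i => s.x - s.w i)
  have h3 := mul_nonneg (shiftWeight_nonneg (N := N) (S := S) (η := η) hL hω)
    (meanSq_nonneg fun i => gradient (f i) (s.w i) - s.hloc i)
  unfold lyapunov pointError shiftError
  linarith

/-- The conditional expectation of the Lyapunov function after one round. -/
lemma lintegral_lyapunov_step_le (hb : 1 ≤ b) (hL : 0 < L) (hω : 0 ≤ ω) (hS : 1 ≤ S)
    (hSN : S ≤ N) (hf : IsSmooth f L) (hbdd : BddBelow (Set.range (objective f)))
    (hG : IsStochasticGradient f D G σ) (hC : IsCompressor ν C ω)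
    (hκ : ∀ i, IsMinibatchPairLaw (D i) (κ i)) (hη : IsSmallStep N S L ω η) {s : State d N}
    (hs : s.h = (1 / (N : ℝ)) • ∑ i, s.hloc i) :
    ∫⁻ r, ENNReal.ofReal (lyapunov f S L ω η (step G C S η (1 / (1 + ω)) s r)) ∂(roundLaw S κ ν) +
        ENNReal.ofReal (13 / 20 * η * ‖gradient (objective f) s.x‖ ^ 2) ≤
      ENNReal.ofReal (lyapunov f S L ω η s) +
        ENNReal.ofReal (3 * varianceWeight N S L ω η * ((1 + ω) / S) * (σ ^ 2 / b)) := by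
  have := fun i => (hκ i).isProbabilityMeasure
  have := isProbabilityMeasure_noiseLaw (ν := ν) hκ
  have := isProbabilityMeasure_clientLaw hSN
  have hS0 : (0 : ℝ) < S := by exact_mod_cast hS
  have hM := varianceWeight_nonneg (N := N) (S := S) (η := η) hL hω
  set α := 1 / (1 + ω)
  set g := gradient (objective f) s.x with hgdef
  set P := (clientLaw N S).prod (noiseLaw κ ν)
  obtain ⟨hWi, hW⟩ := pointError_step hb hω hS hSN hf hG hC hκ hs η α
  obtain ⟨hHi, hH⟩ := shiftError_step hb hω hS hSN hG hC hκ s η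
  have hgL := memLp_gradEst hSN hG hC hκ s
  -- the part of the objective
  set B : Finset (Fin N) × (Fin N → ClientNoise b Z Ξ) → ℝ := fun p =>
    (objective f s.x - ⨅ x, objective f x) - η * ⟪g, gradEst G C S s p⟫ +
      L / 2 * η ^ 2 * ‖gradEst G C S s p‖ ^ 2 with hB
  have hB1 : Integrable (fun p => (objective f s.x - ⨅ x, objective f x) -
      η * ⟪g, gradEst G C S s p⟫) P :=
    (integrable_const _).sub (((hgL.integrable one_le_two).const_inner g).const_mul η)
  have hB2 : Integrable (fun p => L / 2 * η ^ 2 * ‖gradEst G C S s p‖ ^ 2) P :=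
    (hgL.integrable_norm_pow two_ne_zero).const_mul _
  have hBi : Integrable B P := hB1.add hB2
  have hBle : ∫ p, B p ∂P ≤ (objective f s.x - ⨅ x, objective f x) - η * ‖g‖ ^ 2 +
      L / 2 * η ^ 2 * (‖g‖ ^ 2 + (1 + ω) / S * (gradError f s + σ ^ 2 / b)) := by
    rw [hB, integral_add hB1 hB2, integral_sub (integrable_const _)
      (((hgL.integrable one_le_two).const_inner g).const_mul η), integral_const_mul,
      integral_const_mul, integral_inner (hgL.integrable one_le_two),
      integral_gradEst hb hS hSN hf hG hC hκ hs, ← hgdef, real_inner_self_eq_norm_sq]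
    simp only [integral_const, probReal_univ, one_smul]
    gcongr
    exact integral_norm_sq_gradEst_le hb hω hS hSN hf hG hC hκ hs
  -- The new model depends only on the second sampled set and the noise, so its contribution is
  -- integrated over that marginal.
  have hmp : MeasurePreserving (fun r : RoundNoise N b Z Ξ => (r.1.2, r.2)) (roundLaw S κ ν) P :=
    measurePreserving_snd.prod (MeasurePreserving.id _)
  have hBr : Integrable (fun r : RoundNoise N b Z Ξ => B (r.1.2, r.2)) (roundLaw S κ ν) :=
    hmp.integrable_comp_of_integrable hBi
  have hpt : ∀ r : RoundNoise N b Z Ξ,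
      objective f (step G C S η α s r).x - ⨅ x, objective f x ≤ B (r.1.2, r.2) := by
    intro r
    have h := hf.objective_le (hS.trans hSN) s.x (-(η • estimate G C S s r))
    rw [← sub_eq_add_neg, inner_neg_right, real_inner_smul_right, norm_neg, norm_smul, mul_pow,
      Real.norm_eq_abs, sq_abs, estimate_eq] at h
    simp only [step, hB, estimate_eq]
    linarith
  set U : RoundNoise N b Z Ξ → ℝ := fun r => B (r.1.2, r.2) +
    pointWeight N S L ω η * pointError (step G C S η α s r) +
    shiftWeight N S L ω η * shiftError f (step G C S η α s r) with hU
  have hU1 : Integrable (fun r => B (r.1.2, r.2) +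
      pointWeight N S L ω η * pointError (step G C S η α s r)) (roundLaw S κ ν) :=
    hBr.add (hWi.const_mul _)
  have hUi : Integrable U (roundLaw S κ ν) := hU1.add (hHi.const_mul _)
  have hle : ∀ r, lyapunov f S L ω η (step G C S η α s r) ≤ U r := fun r => by
    have := hpt r
    simp only [lyapunov, hU]
    linarith
  have hUle : ∫ r, U r ∂(roundLaw S κ ν) ≤ lyapunov f S L ω η s - 13 / 20 * η * ‖g‖ ^ 2 +
      3 * varianceWeight N S L ω η * ((1 + ω) / S) * (σ ^ 2 / b) := by
    rw [hU, integral_add hU1 (hHi.const_mul _), integral_add hBr (hWi.const_mul _),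
      integral_const_mul, integral_const_mul, integral_comp_measurePreserving hmp hBi.1]
    exact lyapunov_inequality hS hSN hL hω hη (meanSq_nonneg _) (sq_nonneg _)
      (gradError_le hf (by linarith) s) hW hH hBle
  have hη0 := hη.pos
  have h0 : 0 ≤ 13 / 20 * η * ‖g‖ ^ 2 := by positivity
  have hU0 : 0 ≤ ∫ r, U r ∂(roundLaw S κ ν) := integral_nonneg fun r =>
    (lyapunov_nonneg hL hω hbdd _).trans (hle r)
  -- The expectation is passed to the integrable majorant U; in extended nonnegative integrals the
  -- Lyapunov function after the round needs no integrability proof.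
  calc _ ≤ ∫⁻ r, ENNReal.ofReal (U r) ∂(roundLaw S κ ν) +
        ENNReal.ofReal (13 / 20 * η * ‖g‖ ^ 2) := by
        gcongr with r; exact hle r
    _ = ENNReal.ofReal (∫ r, U r ∂(roundLaw S κ ν) + 13 / 20 * η * ‖g‖ ^ 2) := by
        rw [ENNReal.ofReal_add hU0 h0, ofReal_integral_eq_lintegral_ofReal hUi
          (Filter.Eventually.of_forall fun r => (lyapunov_nonneg hL hω hbdd _).trans (hle r))]
    _ ≤ ENNReal.ofReal (lyapunov f S L ω η s +
        3 * varianceWeight N S L ω η * ((1 + ω) / S) * (σ ^ 2 / b)) :=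
        ENNReal.ofReal_le_ofReal (by linarith)
    _ = _ := ENNReal.ofReal_add (lyapunov_nonneg hL hω hbdd _) (by positivity)

end Lyapunov

/-! ### The iterates as random variables -/

instance {d N : ℕ} : MeasurableSpace (State d N) :=
  MeasurableSpace.comap (fun s => (s.x, s.hloc, s.w, s.h)) inferInstance

section Measurability

variable {d N S b : ℕ} {Z Ξ : Type*} [MeasurableSpace Z] [MeasurableSpace Ξ]
  {f : Fin N → Vec d → ℝ} {G : Fin N → Vec d → Z → Vec d} {C : Vec d → Ξ → Vec d} {L : ℝ}

lemma measurable_state_components : Measurable fun s : State d N => (s.x, s.hloc, s.w, s.h) :=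
  comap_measurable _

lemma measurable_state_x : Measurable fun s : State d N => s.x :=
  measurable_fst.comp measurable_state_components

lemma measurable_state_hloc (i : Fin N) : Measurable fun s : State d N => s.hloc i :=
  (measurable_pi_apply i).comp
    (measurable_fst.comp (measurable_snd.comp measurable_state_components))

lemma measurable_state_w (i : Fin N) : Measurable fun s : State d N => s.w i :=
  (measurable_pi_apply i).comp
    (measurable_fst.comp (measurable_snd.comp (measurable_snd.comp measurable_state_components)))

lemma measurable_state_h : Measurable fun s : State d N => s.h :=
  measurable_snd.comp (measurable_snd.comp (measurable_snd.comp measurable_state_components))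

lemma measurable_state_mk {α : Type*} [MeasurableSpace α] {T : α → State d N}
    (hx : Measurable fun a => (T a).x) (hhloc : ∀ i, Measurable fun a => (T a).hloc i)
    (hw : ∀ i, Measurable fun a => (T a).w i) (hh : Measurable fun a => (T a).h) :
    Measurable T :=
  measurable_comap_iff.2
    (hx.prodMk ((measurable_pi_lambda _ hhloc).prodMk ((measurable_pi_lambda _ hw).prodMk hh)))

lemma measurable_sum_mem {α E : Type*} [MeasurableSpace α] [AddCommMonoid E] [MeasurableSpace E]
    [MeasurableAdd₂ E] {A : α → Finset (Fin N)} (hA : Measurable A) {g : α → Fin N → E}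
    (hg : ∀ i, Measurable fun a => g a i) : Measurable fun a => ∑ i ∈ A a, g a i := by
  have h : (fun a => ∑ i ∈ A a, g a i) = fun a => ∑ i, if i ∈ A a then g a i else 0 := by
    funext a
    simp [Finset.sum_ite_mem]
  rw [h]
  exact Finset.measurable_sum _ fun i _ =>
    Measurable.ite (hA (DiscreteMeasurableSpace.forall_measurableSet {B | i ∈ B})) (hg i)
      measurable_const

lemma measurable_message_joint {g : Vec d → Z → Vec d}
    (hg : Measurable fun q : Vec d × Z => g q.1 q.2)
    (hC : Measurable fun q : Vec d × Ξ => C q.1 q.2) {α : Type*} [MeasurableSpace α]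
    {x h : α → Vec d} {z : α → Fin b → Z} {ξ : α → Ξ} (hx : Measurable x) (hh : Measurable h)
    (hz : Measurable z) (hξ : Measurable ξ) :
    Measurable fun a => C (minibatchGrad g (x a) (z a) - h a) (ξ a) :=
  hC.comp ((((measurable_minibatchGrad hg).comp (hx.prodMk hz)).sub hh).prodMk hξ)

lemma measurable_step (hG : ∀ i, Measurable fun q : Vec d × Z => G i q.1 q.2)
    (hC : Measurable fun q : Vec d × Ξ => C q.1 q.2) (η α : ℝ) :
    Measurable fun q : State d N × RoundNoise N b Z Ξ => step G C S η α q.1 q.2 := by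
  have hx : Measurable fun q : State d N × RoundNoise N b Z Ξ => q.1.x :=
    measurable_state_x.comp measurable_fst
  have hl : ∀ i, Measurable fun q : State d N × RoundNoise N b Z Ξ => q.1.hloc i :=
    fun i => (measurable_state_hloc i).comp measurable_fst
  have hw : ∀ i, Measurable fun q : State d N × RoundNoise N b Z Ξ => q.1.w i :=
    fun i => (measurable_state_w i).comp measurable_fst
  have hh : Measurable fun q : State d N × RoundNoise N b Z Ξ => q.1.h :=
    measurable_state_h.comp measurable_fst
  have hn : ∀ i, Measurable fun q : State d N × RoundNoise N b Z Ξ => q.2.2 i :=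
    fun i => (measurable_pi_apply i).comp (measurable_snd.comp measurable_snd)
  have hU : ∀ i, Measurable fun q : State d N × RoundNoise N b Z Ξ => messageU G C q.1 q.2 i :=
    fun i => measurable_message_joint (hG i) hC hx (hl i) (hn i).fst.fst (hn i).snd.fst
  have hV : ∀ i, Measurable fun q : State d N × RoundNoise N b Z Ξ => messageV G C q.1 q.2 i :=
    fun i => measurable_message_joint (hG i) hC hx (hl i) (hn i).fst.snd (hn i).snd.snd
  have hA : Measurable fun q : State d N × RoundNoise N b Z Ξ => q.2.1.1 :=
    measurable_snd.fst.fst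
  have hA2 : Measurable fun q : State d N × RoundNoise N b Z Ξ => q.2.1.2 :=
    measurable_snd.fst.snd
  have hmem : ∀ i, MeasurableSet {q : State d N × RoundNoise N b Z Ξ | i ∈ q.2.1.1} :=
    fun i => hA (DiscreteMeasurableSpace.forall_measurableSet {B | i ∈ B})
  refine measurable_state_mk ?_ (fun i => ?_) (fun i => ?_) ?_
  · exact hx.sub ((((measurable_sum_mem hA2 hV).const_smul (1 / (S : ℝ))).add hh).const_smul η)
  · exact Measurable.ite (hmem i) ((hl i).add ((hU i).const_smul α)) (hl i)
  · exact Measurable.ite (hmem i) hx (hw i)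
  · exact hh.add ((measurable_sum_mem hA hU).const_smul (α / (N : ℝ)))

lemma measurable_meanSq {α : Type*} [MeasurableSpace α] {X : α → Fin N → Vec d}
    (hX : ∀ i, Measurable fun a => X a i) : Measurable fun a => meanSq (X a) :=
  (Finset.measurable_sum Finset.univ fun i _ => (hX i).norm.pow_const 2).const_mul (1 / (N : ℝ))

lemma measurable_lyapunov (hf : IsSmooth f L) (hL : 0 ≤ L) (ω η : ℝ) :
    Measurable (lyapunov (d := d) f S L ω η) := by
  have h1 : Measurable fun s : State d N => objective f s.x :=
    hf.differentiable_objective.continuous.measurable.comp measurable_state_x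
  have h2 : Measurable fun s : State d N => pointError s :=
    measurable_meanSq fun i => measurable_state_x.sub (measurable_state_w i)
  have h3 : Measurable fun s : State d N => shiftError f s :=
    measurable_meanSq fun i => ((hf.continuous_gradient hL i).measurable.comp
      (measurable_state_w i)).sub (measurable_state_hloc i)
  exact ((h1.sub_const _).add (h2.const_mul _)).add (h3.const_mul _)

end Measurability

/-! ### Invariant of the server shift, and independence of the state from fresh noise. -/

section Iterates

variable {d N S b : ℕ} {Z Ξ : Type*}
  {G : Fin N → Vec d → Z → Vec d} {C : Vec d → Ξ → Vec d}

/-- The shift of the server is the mean of the local shifts. -/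
lemma run_h (η α : ℝ) (x₀ : Vec d) (h₀ : Fin N → Vec d) (r : ℕ → RoundNoise N b Z Ξ) (t : ℕ) :
    (run G C S η α x₀ h₀ r t).h = (1 / (N : ℝ)) • ∑ i, (run G C S η α x₀ h₀ r t).hloc i := by
  induction t with
  | zero => rfl
  | succ t ih =>
    have h : ∀ i : Fin N, (run G C S η α x₀ h₀ r (t + 1)).hloc i =
        (run G C S η α x₀ h₀ r t).hloc i +
          if i ∈ (r t).1.1 then α • messageU G C (run G C S η α x₀ h₀ r t) (r t) i else 0 := by
      intro i
      simp only [run, step]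
      split_ifs <;> simp
    simp_rw [h, Finset.sum_add_distrib, Finset.sum_ite_mem, Finset.univ_inter, smul_add, ← ih,
      ← Finset.smul_sum, smul_smul]
    simp only [run, step]
    rw [one_div_mul_eq_div]

variable [MeasurableSpace Z] [MeasurableSpace Ξ] {Ω : Type*} [mΩ : MeasurableSpace Ω]
  {μ : Measure Ω} {r : ℕ → Ω → RoundNoise N b Z Ξ}

/-- Adaptedness: the state before round t is a function of the noise of the rounds before t. Its
independence from `r t` rests on this. -/
lemma measurable_run_past (hG : ∀ i, Measurable fun q : Vec d × Z => G i q.1 q.2)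
    (hC : Measurable fun q : Vec d × Ξ => C q.1 q.2) (η α : ℝ) (x₀ : Vec d) (h₀ : Fin N → Vec d)
    (t : ℕ) :
    Measurable[⨆ i ∈ Set.Iio t, MeasurableSpace.comap (r i) inferInstance]
      fun o => run G C S η α x₀ h₀ (fun t' => r t' o) t := by
  induction t with
  | zero => exact @measurable_const _ _ _ (_) _
  | succ t ih =>
    have h1 : Measurable[⨆ i ∈ Set.Iio (t + 1), MeasurableSpace.comap (r i) inferInstance]
        fun o => run G C S η α x₀ h₀ (fun t' => r t' o) t :=
      ih.mono (biSup_mono fun i hi => lt_trans hi (Nat.lt_succ_self t)) le_rfl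
    have h2 : Measurable[⨆ i ∈ Set.Iio (t + 1), MeasurableSpace.comap (r i) inferInstance] (r t) :=
      (comap_measurable (r t)).mono
        (le_biSup (fun i => MeasurableSpace.comap (r i) inferInstance) (Nat.lt_succ_self t)) le_rfl
    exact (measurable_step hG hC η α).comp (Measurable.prodMk h1 h2)

lemma measurable_run (hr : ∀ t, Measurable (r t))
    (hG : ∀ i, Measurable fun q : Vec d × Z => G i q.1 q.2)
    (hC : Measurable fun q : Vec d × Ξ => C q.1 q.2) (η α : ℝ) (x₀ : Vec d) (h₀ : Fin N → Vec d)
    (t : ℕ) : Measurable fun o => run G C S η α x₀ h₀ (fun t' => r t' o) t :=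
  (measurable_run_past hG hC η α x₀ h₀ t).mono (iSup₂_le fun i _ => (hr i).comap_le) le_rfl

/-- The state before a round is independent of the noise of the round. -/
lemma indepFun_run (hr : ∀ t, Measurable (r t)) (hind : iIndepFun r μ)
    (hG : ∀ i, Measurable fun q : Vec d × Z => G i q.1 q.2)
    (hC : Measurable fun q : Vec d × Ξ => C q.1 q.2) (η α : ℝ) (x₀ : Vec d) (h₀ : Fin N → Vec d)
    (t : ℕ) : (fun o => run G C S η α x₀ h₀ (fun t' => r t' o) t) ⟂ᵢ[μ] r t := by
  have h := indep_iSup_of_disjoint (fun i => (hr i).comap_le) hind.iIndep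
    (S := Set.Iio t) (T := {t}) (by simp)
  rw [IndepFun_iff_Indep]
  refine indep_of_indep_of_le h (measurable_run_past hG hC η α x₀ h₀ t).comap_le ?_
  exact le_biSup (fun i => MeasurableSpace.comap (r i) inferInstance) (Set.mem_singleton t)

/-- The Markov property: the joint law of the state and the fresh noise is a product, so Tonelli
integrates the noise with the state frozen. One-round bounds proved for a fixed state thereby apply
to random states. -/
lemma lintegral_run_succ [IsProbabilityMeasure μ] (hr : ∀ t, Measurable (r t))
    (hind : iIndepFun r μ) (hG : ∀ i, Measurable fun q : Vec d × Z => G i q.1 q.2)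
    (hC : Measurable fun q : Vec d × Ξ => C q.1 q.2) (η α : ℝ) (x₀ : Vec d) (h₀ : Fin N → Vec d)
    (t : ℕ) {ρ : Measure (RoundNoise N b Z Ξ)} [IsProbabilityMeasure ρ] (hlaw : μ.map (r t) = ρ)
    {F : State d N → ENNReal} (hF : Measurable F) :
    ∫⁻ o, F (run G C S η α x₀ h₀ (fun t' => r t' o) (t + 1)) ∂μ =
      ∫⁻ o, ∫⁻ n, F (step G C S η α (run G C S η α x₀ h₀ (fun t' => r t' o) t) n) ∂ρ ∂μ := by
  have hX := measurable_run (S := S) hr hG hC η α x₀ h₀ t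
  have hmap := (indepFun_iff_map_prod_eq_prod_map_map hX.aemeasurable (hr t).aemeasurable).1
    (indepFun_run (S := S) hr hind hG hC η α x₀ h₀ t)
  have hFs : Measurable fun q : State d N × RoundNoise N b Z Ξ => F (step G C S η α q.1 q.2) :=
    hF.comp (measurable_step hG hC η α)
  have : IsProbabilityMeasure (μ.map fun o => run G C S η α x₀ h₀ (fun t' => r t' o) t) :=
    Measure.isProbabilityMeasure_map hX.aemeasurable
  rw [hlaw] at hmap
  calc _ = ∫⁻ q, F (step G C S η α q.1 q.2)
        ∂(μ.map fun o => (run G C S η α x₀ h₀ (fun t' => r t' o) t, r t o)) :=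
        (lintegral_map hFs (hX.prodMk (hr t))).symm
    _ = _ := by
        rw [hmap, lintegral_prod _ hFs.aemeasurable, lintegral_map hFs.lintegral_prod_right' hX]

end Iterates

/-! ### Summation over the rounds -/

section Telescope

variable {d N S b : ℕ} {Z Ξ : Type*} [MeasurableSpace Z] [MeasurableSpace Ξ]
  {f : Fin N → Vec d → ℝ} {D : Fin N → Measure Z} [∀ i, IsProbabilityMeasure (D i)]
  {G : Fin N → Vec d → Z → Vec d} {σ : ℝ}
  {ν : Measure Ξ} [IsProbabilityMeasure ν] {C : Vec d → Ξ → Vec d} {L ω η : ℝ}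
  {κ : Fin N → Measure ((Fin b → Z) × (Fin b → Z))}
  {Ω : Type*} [MeasurableSpace Ω] {μ : Measure Ω} [IsProbabilityMeasure μ]
  {r : ℕ → Ω → RoundNoise N b Z Ξ}

/-- Telescoping with every term on the side where it is added, since subtraction of extended
nonnegative numbers truncates. -/
lemma lintegral_lyapunov_add_sum_le (hb : 1 ≤ b) (hL : 0 < L) (hω : 0 ≤ ω) (hS : 1 ≤ S)
    (hSN : S ≤ N) (hf : IsSmooth f L) (hbdd : BddBelow (Set.range (objective f)))
    (hG : IsStochasticGradient f D G σ) (hC : IsCompressor ν C ω)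
    (hκ : ∀ i, IsMinibatchPairLaw (D i) (κ i)) (hη : IsSmallStep N S L ω η)
    (hr : ∀ t, Measurable (r t)) (hind : iIndepFun r μ)
    (hlaw : ∀ t, μ.map (r t) = roundLaw S κ ν) (x₀ : Vec d) (h₀ : Fin N → Vec d) (T : ℕ) :
    ∫⁻ o, ENNReal.ofReal (lyapunov f S L ω η
        (run G C S η (1 / (1 + ω)) x₀ h₀ (fun t' => r t' o) T)) ∂μ +
      ∑ t ∈ Finset.range T, ∫⁻ o, ENNReal.ofReal (13 / 20 * η * ‖gradient (objective f)
        (run G C S η (1 / (1 + ω)) x₀ h₀ (fun t' => r t' o) t).x‖ ^ 2) ∂μ ≤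
      ENNReal.ofReal (lyapunov f S L ω η (initState x₀ h₀)) +
        T * ENNReal.ofReal (3 * varianceWeight N S L ω η * ((1 + ω) / S) * (σ ^ 2 / b)) := by
  have := isProbabilityMeasure_roundLaw (S := S) (ν := ν) hSN hκ
  set δ := ENNReal.ofReal (3 * varianceWeight N S L ω η * ((1 + ω) / S) * (σ ^ 2 / b))
  set X : ℕ → Ω → State d N := fun t o => run G C S η (1 / (1 + ω)) x₀ h₀ (fun t' => r t' o) t
  have hΦ : Measurable fun s : State d N => ENNReal.ofReal (lyapunov f S L ω η s) :=
    (measurable_lyapunov hf hL.le ω η).ennreal_ofReal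
  have hgrad : Measurable fun s : State d N =>
      ENNReal.ofReal (13 / 20 * η * ‖gradient (objective f) s.x‖ ^ 2) :=
    ((((hf.continuous_gradient_objective hL.le).measurable.comp measurable_state_x).norm.pow_const
      2).const_mul _).ennreal_ofReal
  have hX : ∀ t, Measurable (X t) := measurable_run hr hG.measurable hC.measurable _ _ x₀ h₀
  induction T with
  | zero => simp [run]
  | succ T ih =>
    have hgT : Measurable fun o =>
        ENNReal.ofReal (13 / 20 * η * ‖gradient (objective f) (X T o).x‖ ^ 2) := hgrad.comp (hX T)
    have hstep : ∫⁻ o, ENNReal.ofReal (lyapunov f S L ω η (X (T + 1) o)) ∂μ +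
        ∫⁻ o, ENNReal.ofReal (13 / 20 * η * ‖gradient (objective f) (X T o).x‖ ^ 2) ∂μ ≤
        ∫⁻ o, ENNReal.ofReal (lyapunov f S L ω η (X T o)) ∂μ + δ := by
      rw [lintegral_run_succ hr hind hG.measurable hC.measurable _ _ x₀ h₀ T (hlaw T) hΦ,
        ← lintegral_add_right _ hgT]
      calc _ ≤ ∫⁻ o, (ENNReal.ofReal (lyapunov f S L ω η (X T o)) + δ) ∂μ :=
            lintegral_mono fun o => lintegral_lyapunov_step_le hb hL hω hS hSN hf hbdd hG hC hκ hη
              (run_h _ _ _ _ _ _)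
        _ = _ := by rw [lintegral_add_right _ measurable_const]; simp
    rw [Finset.sum_range_succ]
    calc _ = ∑ t ∈ Finset.range T,
            ∫⁻ o, ENNReal.ofReal (13 / 20 * η * ‖gradient (objective f) (X t o).x‖ ^ 2) ∂μ +
          (∫⁻ o, ENNReal.ofReal (lyapunov f S L ω η (X (T + 1) o)) ∂μ +
          ∫⁻ o, ENNReal.ofReal (13 / 20 * η * ‖gradient (objective f) (X T o).x‖ ^ 2) ∂μ) := by
          ring
      _ ≤ _ := add_le_add le_rfl hstep
      _ = (∫⁻ o, ENNReal.ofReal (lyapunov f S L ω η (X T o)) ∂μ + ∑ t ∈ Finset.range T,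
            ∫⁻ o, ENNReal.ofReal (13 / 20 * η * ‖gradient (objective f) (X t o).x‖ ^ 2) ∂μ) +
            δ := by ring
      _ ≤ _ := add_le_add ih le_rfl
      _ = _ := by push_cast; ring

/-- The sum of the expected squared gradient norms. -/
lemma sum_integral_norm_sq_gradient_le (hb : 1 ≤ b) (hL : 0 < L) (hω : 0 ≤ ω) (hS : 1 ≤ S)
    (hSN : S ≤ N) (hf : IsSmooth f L) (hbdd : BddBelow (Set.range (objective f)))
    (hG : IsStochasticGradient f D G σ) (hC : IsCompressor ν C ω)
    (hκ : ∀ i, IsMinibatchPairLaw (D i) (κ i)) (hη : IsSmallStep N S L ω η)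
    (hr : ∀ t, Measurable (r t)) (hind : iIndepFun r μ)
    (hlaw : ∀ t, μ.map (r t) = roundLaw S κ ν) (x₀ : Vec d) (h₀ : Fin N → Vec d) :
    (∀ t, Integrable (fun o => ‖gradient (objective f)
        (run G C S η (1 / (1 + ω)) x₀ h₀ (fun t' => r t' o) t).x‖ ^ 2) μ) ∧
    ∀ T : ℕ, 13 / 20 * η * ∑ t ∈ Finset.range T, ∫ o, ‖gradient (objective f)
        (run G C S η (1 / (1 + ω)) x₀ h₀ (fun t' => r t' o) t).x‖ ^ 2 ∂μ ≤
      lyapunov f S L ω η (initState x₀ h₀) +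
        T * (3 * varianceWeight N S L ω η * ((1 + ω) / S) * (σ ^ 2 / b)) := by
  have key := lintegral_lyapunov_add_sum_le hb hL hω hS hSN hf hbdd hG hC hκ hη hr hind hlaw x₀ h₀
  have hM := varianceWeight_nonneg (N := N) (S := S) (η := η) hL hω
  have hΦ0 := lyapunov_nonneg (S := S) (η := η) hL hω hbdd (initState x₀ h₀)
  have hη0 := hη.pos
  set δ := 3 * varianceWeight N S L ω η * ((1 + ω) / S) * (σ ^ 2 / b) with hδ
  have hδ0 : 0 ≤ δ := by positivity
  set g : ℕ → Ω → ℝ := fun t o => ‖gradient (objective f)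
    (run G C S η (1 / (1 + ω)) x₀ h₀ (fun t' => r t' o) t).x‖ ^ 2 with hg
  have hgm : ∀ t, Measurable (g t) := fun t =>
    ((hf.continuous_gradient_objective hL.le).measurable.comp (measurable_state_x.comp
      (measurable_run hr hG.measurable hC.measurable _ _ x₀ h₀ t))).norm.pow_const 2
  have hgi : ∀ t, Integrable (g t) μ := fun t => by
    have hlt : ∫⁻ o, ENNReal.ofReal (13 / 20 * η * g t o) ∂μ < ⊤ := by
      -- A single term is at most the sum over the first t + 1 rounds, which the telescoped bound
      -- makes finite.
      refine lt_of_le_of_lt ((Finset.single_le_sum (f := fun t =>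
        ∫⁻ o, ENNReal.ofReal (13 / 20 * η * g t o) ∂μ) (fun _ _ => zero_le)
        (Finset.self_mem_range_succ t)).trans (le_add_self.trans (key (t + 1)))) ?_
      exact ENNReal.add_lt_top.2 ⟨ENNReal.ofReal_lt_top,
        ENNReal.mul_lt_top (ENNReal.natCast_lt_top _) ENNReal.ofReal_lt_top⟩
    have hi : Integrable (fun o => 13 / 20 * η * g t o) μ := by
      refine ⟨((hgm t).const_mul _).aestronglyMeasurable, ?_⟩
      rw [hasFiniteIntegral_iff_ofReal (Filter.Eventually.of_forall fun o => by positivity)]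
      exact hlt
    exact (integrable_const_mul_iff (IsUnit.mk0 (13 / 20 * η) (by positivity)) _).1 hi
  refine ⟨hgi, fun T => ?_⟩
  have h1 : ∀ t, ∫⁻ o, ENNReal.ofReal (13 / 20 * η * g t o) ∂μ =
      ENNReal.ofReal (13 / 20 * η * ∫ o, g t o ∂μ) := fun t => by
    rw [← integral_const_mul, ofReal_integral_eq_lintegral_ofReal ((hgi t).const_mul _)
      (Filter.Eventually.of_forall fun o => by positivity)]
  have h2 : ∑ t ∈ Finset.range T, ∫⁻ o, ENNReal.ofReal (13 / 20 * η * g t o) ∂μ ≤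
      ENNReal.ofReal (lyapunov f S L ω η (initState x₀ h₀)) + T * ENNReal.ofReal δ :=
    le_add_self.trans (key T)
  rw [Finset.sum_congr rfl fun t _ => h1 t, ← ENNReal.ofReal_sum_of_nonneg fun t _ =>
    mul_nonneg (by positivity) (integral_nonneg fun o => by positivity), ← Finset.mul_sum,
    ← ENNReal.ofReal_natCast, ← ENNReal.ofReal_mul (by positivity),
    ← ENNReal.ofReal_add hΦ0 (by positivity)] at h2
  exact (ENNReal.ofReal_le_ofReal_iff (by positivity)).1 h2

end Telescope

/-! ### The step size and the rate -/

section StepSize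

variable {N S b : ℕ} {L Λ σ ω ε : ℝ}

lemma stepSize_pos (hS : 1 ≤ S) (hSN : S ≤ N) (hb : 1 ≤ b) (hL : 0 < L) (hΛ : L ≤ Λ)
    (hσ : 0 ≤ σ) (hω : 0 ≤ ω) (hε : 0 < ε) : 0 < stepSize N S b L Λ σ ω ε := by
  have hS0 : (0 : ℝ) < S := by exact_mod_cast hS
  have hN0 : (0 : ℝ) < N := by exact_mod_cast hS.trans hSN
  have hb0 : (0 : ℝ) < b := by exact_mod_cast hb
  have hΛ0 : 0 < Λ := hL.trans_le hΛ
  have h3 : 0 < min (1 / (2 * L)) (min ((S : ℝ) / (5 * L * (1 + ω) * (N : ℝ) ^ (2 / 3 : ℝ)))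
      ((S : ℝ) / (5 * L * (1 + ω) ^ (3 / 2 : ℝ) * Real.sqrt N))) := by
    refine lt_min (by positivity) (lt_min (by positivity) (by positivity))
  unfold stepSize
  split_ifs with h
  · exact h3
  · have : 0 < σ := lt_of_le_of_ne hσ (Ne.symm h)
    exact lt_min h3 (by positivity)

lemma stepSize_le_min : stepSize N S b L Λ σ ω ε ≤
    min (1 / (2 * L)) (min ((S : ℝ) / (5 * L * (1 + ω) * (N : ℝ) ^ (2 / 3 : ℝ)))
      ((S : ℝ) / (5 * L * (1 + ω) ^ (3 / 2 : ℝ) * Real.sqrt N))) := by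
  unfold stepSize
  split_ifs
  · exact le_rfl
  · exact min_le_left _ _

/-- The bound with √N is squared to give `le_sqrt`, and the bound with N^(2/3) is cubed to give
`le_rpow`; 1/25 and 1/125 are powers of the 5 in the step size. -/
lemma isSmallStep_stepSize (hS : 1 ≤ S) (hSN : S ≤ N) (hb : 1 ≤ b) (hL : 0 < L) (hΛ : L ≤ Λ)
    (hσ : 0 ≤ σ) (hω : 0 ≤ ω) (hε : 0 < ε) :
    IsSmallStep N S L ω (stepSize N S b L Λ σ ω ε) := by
  have hS0 : (0 : ℝ) < S := by exact_mod_cast hS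
  have hN0 : (0 : ℝ) < N := by exact_mod_cast hS.trans hSN
  have hq : 0 < 1 + ω := by linarith
  have hpos := stepSize_pos hS hSN hb hL hΛ hσ hω hε
  have hle := stepSize_le_min (N := N) (S := S) (b := b) (L := L) (Λ := Λ) (σ := σ) (ω := ω)
    (ε := ε)
  set η := stepSize N S b L Λ σ ω ε
  have h1 := hle.trans (min_le_left _ _)
  have h2 := (hle.trans (min_le_right _ _)).trans (min_le_left _ _)
  have h3 := (hle.trans (min_le_right _ _)).trans (min_le_right _ _)
  rw [le_div_iff₀ (by positivity)] at h1 h2 h3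
  have hc1 : ((1 + ω) ^ (3 / 2 : ℝ)) ^ 2 = (1 + ω) ^ 3 := by
    rw [← Real.rpow_natCast, ← Real.rpow_mul hq.le, ← Real.rpow_natCast]
    norm_num
  have hc2 : ((N : ℝ) ^ (2 / 3 : ℝ)) ^ 3 = (N : ℝ) ^ 2 := by
    rw [← Real.rpow_natCast, ← Real.rpow_mul hN0.le, ← Real.rpow_natCast]
    norm_num
  refine ⟨hpos, by linarith, ?_, ?_⟩
  · have h := pow_le_pow_left₀ (by positivity) h3 2
    rw [div_le_iff₀ (by positivity)]
    have e : (η * (5 * L * (1 + ω) ^ (3 / 2 : ℝ) * √(N : ℝ))) ^ 2 =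
        25 * ((1 + ω) ^ 3 * N * L ^ 2 * η ^ 2) := by
      simp only [mul_pow, Real.sq_sqrt hN0.le, hc1]; ring
    linarith
  · have h := pow_le_pow_left₀ (by positivity) h2 3
    have e : (η * (5 * L * (1 + ω) * (N : ℝ) ^ (2 / 3 : ℝ))) ^ 3 =
        125 * ((1 + ω) ^ 3 * N ^ 2 * L ^ 3 * η ^ 3) := by
      simp only [mul_pow, hc2]; ring
    have e2 : (1 + ω) ^ 3 * N * L ^ 2 * η ^ 2 / (S : ℝ) ^ 2 * (L * η) * ((N : ℝ) / S) =
        ((1 + ω) ^ 3 * N ^ 2 * L ^ 3 * η ^ 3) / (S : ℝ) ^ 3 := by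
      field_simp
    rw [e2, div_le_iff₀ (by positivity)]
    linarith

/-- The fourth term of the step size gives (L / Λ)ε², which is where L ≤ Λ is needed. -/
lemma noise_le (hS : 1 ≤ S) (hb : 1 ≤ b) (hL : 0 < L) (hΛ : L ≤ Λ) (hω : 0 ≤ ω) :
    20 * L * stepSize N S b L Λ σ ω ε * ((1 + ω) / S) * (σ ^ 2 / b) ≤ ε ^ 2 := by
  have hS0 : (0 : ℝ) < S := by exact_mod_cast hS
  have hb0 : (0 : ℝ) < b := by exact_mod_cast hb
  have hΛ0 : 0 < Λ := hL.trans_le hΛ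
  by_cases h : σ = 0
  · simp [h]; positivity
  · have h1 : stepSize N S b L Λ σ ω ε ≤
        (b : ℝ) * S * ε ^ 2 / (20 * Λ * (1 + ω) * σ ^ 2) := by
      unfold stepSize
      simp only [if_neg h]
      exact min_le_right _ _
    have h2 : 20 * L * stepSize N S b L Λ σ ω ε * ((1 + ω) / S) * (σ ^ 2 / b) ≤
        20 * L * ((b : ℝ) * S * ε ^ 2 / (20 * Λ * (1 + ω) * σ ^ 2)) * ((1 + ω) / S) *
          (σ ^ 2 / b) := by gcongr
    have h3 : 20 * L * ((b : ℝ) * S * ε ^ 2 / (20 * Λ * (1 + ω) * σ ^ 2)) * ((1 + ω) / S) *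
          (σ ^ 2 / b) = L / Λ * ε ^ 2 := by
      have := sq_pos_of_ne_zero h
      field_simp
    rw [h3] at h2
    exact h2.trans (mul_le_of_le_one_left (by positivity) ((div_le_one hΛ0).2 hΛ))

lemma rate_nonneg (hL : 0 < L) (hΛ : L ≤ Λ) (hω : 0 ≤ ω) : 0 ≤ rate N S b L Λ σ ω ε := by
  have hΛ0 : 0 < Λ := hL.trans_le hΛ
  unfold rate
  positivity

/-- The step size equals one of its candidates. That candidate times the matching term of the rate
times 20ε² is 10, 4, 4 or 1, and the other terms of the rate are nonnegative. The factor 20 is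
forced by the noise term. -/
lemma one_le_stepSize_mul_rate (hS : 1 ≤ S) (hSN : S ≤ N) (hb : 1 ≤ b) (hL : 0 < L) (hΛ : L ≤ Λ)
    (hσ : 0 ≤ σ) (hω : 0 ≤ ω) (hε : 0 < ε) :
    1 ≤ 20 * ε ^ 2 * stepSize N S b L Λ σ ω ε * rate N S b L Λ σ ω ε := by
  have hS0 : (0 : ℝ) < S := by exact_mod_cast hS
  have hN0 : (0 : ℝ) < N := by exact_mod_cast hS.trans hSN
  have hb0 : (0 : ℝ) < b := by exact_mod_cast hb
  have hΛ0 : 0 < Λ := hL.trans_le hΛ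
  have hpos := stepSize_pos hS hSN hb hL hΛ hσ hω hε
  set r₁ := L / ε ^ 2
  set r₂ := L * (1 + ω) * (N : ℝ) ^ (2 / 3 : ℝ) / (S * ε ^ 2)
  set r₃ := L * (1 + ω) ^ (3 / 2 : ℝ) * Real.sqrt N / (S * ε ^ 2)
  set r₄ := Λ * (1 + ω) * σ ^ 2 / (b * S * ε ^ 4)
  have h1 : 0 ≤ r₁ := by positivity
  have h2 : 0 ≤ r₂ := by positivity
  have h3 : 0 ≤ r₃ := by positivity
  have h4 : 0 ≤ r₄ := by positivity
  have hR : rate N S b L Λ σ ω ε = r₁ + r₂ + r₃ + r₄ := rfl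
  have main : ∀ ρ, 0 < stepSize N S b L Λ σ ω ε → ρ ≤ r₁ + r₂ + r₃ + r₄ →
      1 ≤ 20 * ε ^ 2 * stepSize N S b L Λ σ ω ε * ρ →
      1 ≤ 20 * ε ^ 2 * stepSize N S b L Λ σ ω ε * rate N S b L Λ σ ω ε := by
    intro ρ hη hρ h
    rw [hR]
    exact h.trans (mul_le_mul_of_nonneg_left hρ (by positivity))
  have c1 : stepSize N S b L Λ σ ω ε = 1 / (2 * L) →
      1 ≤ 20 * ε ^ 2 * stepSize N S b L Λ σ ω ε * rate N S b L Λ σ ω ε := fun h =>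
    main r₁ hpos (by linarith) (by
      rw [h, show 20 * ε ^ 2 * (1 / (2 * L)) * r₁ = 10 by simp only [r₁]; field_simp; norm_num]
      norm_num)
  have c2 : stepSize N S b L Λ σ ω ε = (S : ℝ) / (5 * L * (1 + ω) * (N : ℝ) ^ (2 / 3 : ℝ)) →
      1 ≤ 20 * ε ^ 2 * stepSize N S b L Λ σ ω ε * rate N S b L Λ σ ω ε := fun h =>
    main r₂ hpos (by linarith) (by
      rw [h, show 20 * ε ^ 2 * ((S : ℝ) / (5 * L * (1 + ω) * (N : ℝ) ^ (2 / 3 : ℝ))) * r₂ = 4 by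
        simp only [r₂]
        have : 0 < (N : ℝ) ^ (2 / 3 : ℝ) := by positivity
        generalize (N : ℝ) ^ (2 / 3 : ℝ) = y at this
        field_simp; norm_num]
      norm_num)
  have c3 : stepSize N S b L Λ σ ω ε =
      (S : ℝ) / (5 * L * (1 + ω) ^ (3 / 2 : ℝ) * Real.sqrt N) →
      1 ≤ 20 * ε ^ 2 * stepSize N S b L Λ σ ω ε * rate N S b L Λ σ ω ε := fun h =>
    main r₃ hpos (by linarith) (by
      rw [h, show 20 * ε ^ 2 * ((S : ℝ) / (5 * L * (1 + ω) ^ (3 / 2 : ℝ) * Real.sqrt N)) * r₃ = 4 by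
        simp only [r₃]
        have h5 : 0 < (1 + ω) ^ (3 / 2 : ℝ) := by positivity
        have h6 : 0 < Real.sqrt N := by positivity
        generalize (1 + ω) ^ (3 / 2 : ℝ) = y at h5
        generalize Real.sqrt N = z at h6
        field_simp; norm_num]
      norm_num)
  have c4 : σ ≠ 0 → stepSize N S b L Λ σ ω ε =
      (b : ℝ) * S * ε ^ 2 / (20 * Λ * (1 + ω) * σ ^ 2) →
      1 ≤ 20 * ε ^ 2 * stepSize N S b L Λ σ ω ε * rate N S b L Λ σ ω ε := fun h0 h =>
    main r₄ hpos (by linarith) (by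
      rw [h, show 20 * ε ^ 2 * ((b : ℝ) * S * ε ^ 2 / (20 * Λ * (1 + ω) * σ ^ 2)) * r₄ = 1 by
        simp only [r₄]; field_simp])
  have hmin : ∀ a b c : ℝ, min a (min b c) = a ∨ min a (min b c) = b ∨ min a (min b c) = c := by
    intro a b c
    rcases min_choice a (min b c) with h | h
    · exact Or.inl h
    · rw [h]; exact Or.inr (min_choice b c)
  have c123 : stepSize N S b L Λ σ ω ε =
      min (1 / (2 * L)) (min ((S : ℝ) / (5 * L * (1 + ω) * (N : ℝ) ^ (2 / 3 : ℝ)))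
        ((S : ℝ) / (5 * L * (1 + ω) ^ (3 / 2 : ℝ) * Real.sqrt N))) →
      1 ≤ 20 * ε ^ 2 * stepSize N S b L Λ σ ω ε * rate N S b L Λ σ ω ε := fun h => by
    rcases hmin (1 / (2 * L)) ((S : ℝ) / (5 * L * (1 + ω) * (N : ℝ) ^ (2 / 3 : ℝ)))
      ((S : ℝ) / (5 * L * (1 + ω) ^ (3 / 2 : ℝ) * Real.sqrt N)) with h' | h' | h'
    · exact c1 (h.trans h')
    · exact c2 (h.trans h')
    · exact c3 (h.trans h')
  by_cases h0 : σ = 0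
  · exact c123 (by simp only [stepSize, if_pos h0])
  · have hdef : stepSize N S b L Λ σ ω ε =
        min (min (1 / (2 * L)) (min ((S : ℝ) / (5 * L * (1 + ω) * (N : ℝ) ^ (2 / 3 : ℝ)))
          ((S : ℝ) / (5 * L * (1 + ω) ^ (3 / 2 : ℝ) * Real.sqrt N))))
          ((b : ℝ) * S * ε ^ 2 / (20 * Λ * (1 + ω) * σ ^ 2)) := by
      simp only [stepSize, if_neg h0]
    rcases min_choice (min (1 / (2 * L)) (min ((S : ℝ) / (5 * L * (1 + ω) * (N : ℝ) ^ (2 / 3 : ℝ)))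
        ((S : ℝ) / (5 * L * (1 + ω) ^ (3 / 2 : ℝ) * Real.sqrt N))))
        ((b : ℝ) * S * ε ^ 2 / (20 * Λ * (1 + ω) * σ ^ 2)) with h | h
    · exact c123 (hdef.trans h)
    · exact c4 h0 (hdef.trans h)

end StepSize

/-! ### The Lyapunov function at the start. -/

section Initial

variable {d N S : ℕ} {f : Fin N → Vec d → ℝ} {L ω η : ℝ}

/-- All virtual points start at x₀, so the term with W vanishes and H is the initial error of the
shifts. -/
lemma lyapunov_initState_le (hL : 0 < L) (hω : 0 ≤ ω) (hη : IsSmallStep N S L ω η)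
    (x₀ : Vec d) (h₀ : Fin N → Vec d) :
    lyapunov f S L ω η (initState x₀ h₀) ≤ initialError f L x₀ h₀ := by
  have h1 : pointError (initState x₀ h₀) = 0 := by simp [pointError, initState, meanSq]
  have h2 : shiftError f (initState x₀ h₀) =
      (1 / (N : ℝ)) * ∑ i, ‖h₀ i - gradient (f i) x₀‖ ^ 2 := by
    simp only [shiftError, initState, meanSq]
    simp_rw [norm_sub_rev]
  have h3 : 0 ≤ (1 / (N : ℝ)) * ∑ i, ‖h₀ i - gradient (f i) x₀‖ ^ 2 := by positivity
  unfold lyapunov initialError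
  rw [h1, h2, mul_zero, add_zero]
  exact add_le_add le_rfl (mul_le_mul_of_nonneg_right (shiftWeight_le hL hω hη) h3)

lemma initialError_nonneg (hL : 0 < L) (hbdd : BddBelow (Set.range (objective f))) (x₀ : Vec d)
    (h₀ : Fin N → Vec d) : 0 ≤ initialError f L x₀ h₀ := by
  have h1 := ciInf_le hbdd x₀
  have h2 : 0 ≤ (1 / L) * ((1 / (N : ℝ)) * ∑ i, ‖h₀ i - gradient (f i) x₀‖ ^ 2) := by positivity
  unfold initialError
  linarith

end Initial

/-! ### Conclusion -/

/-- Integrating 2εy ≤ y² + ε² takes the place of Jensen's inequality in both the expectation and the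
average over t. -/
lemma expectation_le_of_sum_sq_le {Ω : Type*} [MeasurableSpace Ω] {μ : Measure Ω}
    [IsProbabilityMeasure μ] {Y : ℕ → Ω → ℝ} (hY : ∀ t, Integrable (Y t) μ)
    (hY2 : ∀ t, Integrable (fun o => Y t o ^ 2) μ) {ε : ℝ} (hε : 0 < ε) {T : ℕ} (hT : 1 ≤ T)
    (h : ∑ t ∈ Finset.range T, ∫ o, Y t o ^ 2 ∂μ ≤ T * ε ^ 2) :
    (1 / (T : ℝ)) * ∑ t ∈ Finset.range T, ∫ o, Y t o ∂μ ≤ ε := by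
  have hT0 : (0 : ℝ) < T := by exact_mod_cast hT
  have h1 : ∀ t, 2 * ε * ∫ o, Y t o ∂μ ≤ ∫ o, Y t o ^ 2 ∂μ + ε ^ 2 := fun t => by
    rw [← integral_const_mul]
    have h2 : ∫ o, (Y t o ^ 2 + ε ^ 2) ∂μ = ∫ o, Y t o ^ 2 ∂μ + ε ^ 2 := by
      rw [integral_add (hY2 t) (integrable_const _)]; simp
    rw [← h2]
    exact integral_mono ((hY t).const_mul _) ((hY2 t).add (integrable_const _)) fun o => by
      nlinarith [sq_nonneg (Y t o - ε)]
  have h3 := Finset.sum_le_sum fun t (_ : t ∈ Finset.range T) => h1 t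
  rw [← Finset.mul_sum, Finset.sum_add_distrib, Finset.sum_const, Finset.card_range,
    nsmul_eq_mul] at h3
  rw [one_div, inv_mul_le_iff₀ hT0]
  have h4 : 2 * ε * ∑ t ∈ Finset.range T, ∫ o, Y t o ∂μ ≤ 2 * ε * (T * ε) := by linarith
  exact le_of_mul_le_mul_left h4 (by positivity)

end Cofig

end

theorem mainTheorem1 :
    ∃ K : ℝ, 0 < K ∧
      ∀ (d N S b : ℕ) (_ : 1 ≤ S) (_ : S ≤ N) (_ : 1 ≤ b)
        (L Λ σ ω ε : ℝ) (_ : 0 < L) (_ : L ≤ Λ) (_ : 0 ≤ σ) (_ : 0 ≤ ω) (_ : 0 < ε)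
        -- the local functions
        (f : Fin N → Cofig.Vec d → ℝ) (_ : Cofig.IsSmooth f L)
        (_ : BddBelow (Set.range (Cofig.objective f)))
        -- the local data distributions and the stochastic gradients
        (Z : Type u) [MeasurableSpace Z]
        (D : Fin N → Measure Z) (_ : ∀ i, IsProbabilityMeasure (D i))
        (G : Fin N → Cofig.Vec d → Z → Cofig.Vec d)
        (_ : Cofig.IsStochasticGradient f D G σ)
        -- the compression operator
        (Ξ : Type v) [MeasurableSpace Ξ] (ν : Measure Ξ) (_ : IsProbabilityMeasure ν)
        (C : Cofig.Vec d → Ξ → Cofig.Vec d) (_ : Cofig.IsCompressor ν C ω)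
        -- the initialization
        (x₀ : Cofig.Vec d) (h₀ : Fin N → Cofig.Vec d)
        -- the randomness: independent rounds, each with the law of a round
        (κ : Fin N → Measure ((Fin b → Z) × (Fin b → Z)))
        (_ : ∀ i, Cofig.IsMinibatchPairLaw (D i) (κ i))
        (Ω : Type w) [MeasurableSpace Ω] (μ : Measure Ω) (_ : IsProbabilityMeasure μ)
        (r : ℕ → Ω → Cofig.RoundNoise N b Z Ξ)
        (_ : iIndepFun r μ) (_ : ∀ t, HasLaw (r t) (Cofig.roundLaw S κ ν) μ)
        -- the model after `t` rounds, with the prescribed step sizes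
        (x : ℕ → Ω → Cofig.Vec d)
        (_ : ∀ t o, x t o =
          (Cofig.run G C S (Cofig.stepSize N S b L Λ σ ω ε) (1 / (1 + ω)) x₀ h₀
            (fun t' => r t' o) t).x),
        (∀ t, Integrable (fun o => ‖gradient (Cofig.objective f) (x t o)‖) μ) ∧
        -- some iterate is good, within the claimed number of rounds
        (∃ t : ℕ, (t : ℝ) ≤
            K * (Cofig.initialError f L x₀ h₀ * Cofig.rate N S b L Λ σ ω ε) ∧
          ∫ o, ‖gradient (Cofig.objective f) (x t o)‖ ∂μ ≤ ε) ∧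
        -- a uniformly random one of the first `T` iterates is good
        (∀ T : ℕ, 1 ≤ T →
          K * (Cofig.initialError f L x₀ h₀ * Cofig.rate N S b L Λ σ ω ε) ≤ (T : ℝ) →
          (1 / (T : ℝ)) *
            ∑ t ∈ Finset.range T, ∫ o, ‖gradient (Cofig.objective f) (x t o)‖ ∂μ ≤ ε) := by
  -- The constant is 5 · 20: the 20 of `one_le_stepSize_mul_rate`, and a 5 that brings the initial
  -- error down to ηε²T / 5.
  refine ⟨100, by norm_num, ?_⟩
  intro d N S b hS hSN hb L Λ σ ω ε hL hΛ hσ hω hε f hf hbdd Z _ D hD G hG Ξ _ ν hν C hC x₀ h₀ κ hκ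
    Ω _ μ hμ r hind hlaw x hx
  have hη := Cofig.isSmallStep_stepSize hS hSN hb hL hΛ hσ hω hε
  have hnoise := Cofig.noise_le (ε := ε) (σ := σ) (N := N) hS hb hL hΛ hω
  have hηR := Cofig.one_le_stepSize_mul_rate hS hSN hb hL hΛ hσ hω hε
  have hR0 := Cofig.rate_nonneg (N := N) (S := S) (b := b) (σ := σ) (ε := ε) hL hΛ hω
  have hΦ0 := Cofig.lyapunov_initState_le (f := f) hL hω hη x₀ h₀
  have hΔ0 := Cofig.initialError_nonneg hL hbdd x₀ h₀
  have hM := Cofig.varianceWeight_le hL hη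
  have hM0 := Cofig.varianceWeight_nonneg (N := N) (S := S)
    (η := Cofig.stepSize N S b L Λ σ ω ε) hL hω
  have hη0 := hη.pos
  set η := Cofig.stepSize N S b L Λ σ ω ε
  set R := Cofig.rate N S b L Λ σ ω ε
  set Δ := Cofig.initialError f L x₀ h₀
  -- a measurable version of the noise
  have hae : ∀ t, r t =ᵐ[μ] (hlaw t).aemeasurable.mk (r t) := fun t => (hlaw t).aemeasurable.ae_eq_mk
  set r' : ℕ → Ω → Cofig.RoundNoise N b Z Ξ := fun t => (hlaw t).aemeasurable.mk (r t)
  have hr' : ∀ t, Measurable (r' t) := fun t => (hlaw t).aemeasurable.measurable_mk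
  have hind' : iIndepFun r' μ := hind.congr hae
  have hlaw' : ∀ t, μ.map (r' t) = Cofig.roundLaw S κ ν := fun t => by
    rw [← Measure.map_congr (hae t), (hlaw t).map_eq]
  obtain ⟨hint, hsum⟩ := Cofig.sum_integral_norm_sq_gradient_le hb hL hω hS hSN hf hbdd hG hC hκ hη
    hr' hind' hlaw' x₀ h₀
  -- There are countably many rounds, so a single null set suffices for all iterates.
  have hx' : ∀ᵐ o ∂μ, ∀ t, x t o =
      (Cofig.run G C S η (1 / (1 + ω)) x₀ h₀ (fun t' => r' t' o) t).x := by
    filter_upwards [ae_all_iff.2 hae] with o ho t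
    rw [hx t o]
    simp_rw [ho]
    rfl
  set Y' : ℕ → Ω → ℝ := fun t o => ‖gradient (Cofig.objective f)
    (Cofig.run G C S η (1 / (1 + ω)) x₀ h₀ (fun t' => r' t' o) t).x‖
  have hYm : ∀ t, Measurable (Y' t) := fun t =>
    ((hf.continuous_gradient_objective hL.le).measurable.comp (Cofig.measurable_state_x.comp
      (Cofig.measurable_run hr' hG.measurable hC.measurable _ _ x₀ h₀ t))).norm
  have hY'i : ∀ t, Integrable (Y' t) μ := fun t =>
    ((memLp_two_iff_integrable_sq (hYm t).aestronglyMeasurable).2 (hint t)).integrable one_le_two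
  have hYY : ∀ t, Y' t =ᵐ[μ] fun o => ‖gradient (Cofig.objective f) (x t o)‖ := fun t => by
    filter_upwards [hx'] with o ho
    rw [ho t]
  have hmain : ∀ T : ℕ, 1 ≤ T → 100 * (Δ * R) ≤ (T : ℝ) →
      (1 / (T : ℝ)) * ∑ t ∈ Finset.range T,
        ∫ o, ‖gradient (Cofig.objective f) (x t o)‖ ∂μ ≤ ε := by
    intro T hT hTK
    simp_rw [← fun t => integral_congr_ae (hYY t)]
    refine Cofig.expectation_le_of_sum_sq_le hY'i hint hε hT ?_
    have hT0 : (0 : ℝ) < T := by exact_mod_cast hT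
    have hδ : 3 * Cofig.varianceWeight N S L ω η * ((1 + ω) / S) * (σ ^ 2 / b) ≤
        3 * (37 / 50) / 20 * (η * ε ^ 2) := by
      have h1 : 3 * Cofig.varianceWeight N S L ω η * ((1 + ω) / S) * (σ ^ 2 / b) ≤
          3 * (37 / 50 * (L * η ^ 2)) * ((1 + ω) / S) * (σ ^ 2 / b) := by gcongr
      have h2 := mul_le_mul_of_nonneg_left hnoise hη0.le
      linarith
    have hΔ : Δ ≤ 1 / 5 * (η * ε ^ 2) * T := by
      have h1 := mul_le_mul_of_nonneg_left hηR hΔ0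
      have h2 := mul_le_mul_of_nonneg_left hTK (by positivity : 0 ≤ 1 / 5 * (η * ε ^ 2))
      linarith
    have h1 := hsum T
    have h2 := mul_le_mul_of_nonneg_left hδ hT0.le
    -- The budget closes since 1/5 + 3(37/50)/20 = 0.311 is less than 13/20.
    have h3 : 13 / 20 * η * ∑ t ∈ Finset.range T, ∫ o, Y' t o ^ 2 ∂μ ≤
        13 / 20 * η * (T * ε ^ 2) := by
      have h4 : 0 ≤ T * (η * ε ^ 2) := by positivity
      refine h1.trans ?_
      linarith
    exact le_of_mul_le_mul_left h3 (by positivity)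
  refine ⟨fun t => (hY'i t).congr (hYY t), ?_, hmain⟩
  -- the best iterate is at least as good as the average
  have hΔR : 0 ≤ 100 * (Δ * R) := by positivity
  -- The maximum with 1 matters only if the bound is 0. It then admits only t = 0, so the good
  -- iterate still satisfies t ≤ 100 Δ R.
  set T := max 1 ⌈100 * (Δ * R)⌉₊ with hTdef
  have hT1 : 1 ≤ T := le_max_left _ _
  have hTK : 100 * (Δ * R) ≤ (T : ℝ) :=
    (Nat.le_ceil _).trans (by exact_mod_cast le_max_right 1 ⌈100 * (Δ * R)⌉₊)
  have hT0 : (0 : ℝ) < T := by exact_mod_cast hT1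
  have hav := hmain T hT1 hTK
  rw [one_div, inv_mul_le_iff₀ hT0] at hav
  obtain ⟨t, ht, hte⟩ : ∃ t ∈ Finset.range T,
      ∫ o, ‖gradient (Cofig.objective f) (x t o)‖ ∂μ ≤ ε := by
    refine Finset.exists_le_of_sum_le (Finset.nonempty_range_iff.2 (by omega)) ?_
    simpa using hav
  refine ⟨t, ?_, hte⟩
  rcases Nat.eq_zero_or_pos t with h0 | h0
  · rw [h0]; simpa using hΔR
  · have h1 : t < ⌈100 * (Δ * R)⌉₊ := by
      rcases lt_max_iff.1 (Finset.mem_range.1 ht) with h | h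
      · omega
      · exact h
    exact (Nat.lt_ceil.1 h1).le
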